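/- Fix an integer $k\ge 2$. For $0<\alpha<\pi/2$ put $x=\cot\alpha$ and let $S_\alpha$ be the Riemann surface of pairs $(z,u)$ with $$z^{-1}-z=(x+x^{-1})\,u^{-k}-(x-x^{-1}).$$ Let $\gamma_1=\gamma_1^{\alpha}$ be the curve on $S_\alpha$ along which $u=e^{i\phi}$, where $\phi$ increases from $0$ to $2\alpha/k$ and then decreases back to $0$, and along which $z$ runs from $\sec\alpha-\tan\alpha$ through the upper half plane to $-(\sec\alpha+\tan\alpha)$, passing through the branch point $z=i$ of $u$ when $\phi=2\alpha/k$. Put $\tilde\alpha=\frac{\pi}{2}-\alpha$ and $\tilde m=-m$. The substitution $(\tilde z,\tilde u)=(-z,e^{i\pi/k}u)$ carries $S_\alpha$ to $S_{\tilde\alpha}$; let $\gamma_2$ be the curve on $S_\alpha$ that it carries to $\gamma_1^{\tilde\alpha}$. Define, for real $m$, $$Q_1(m,\alpha)=\operatorname{Re}\int_{\gamma_1}-i\Big(\frac{1+mz}{z}\Big)^2u^{k+1}\,dz,\qquad C_1(\alpha)=\operatorname{Re}\int_{\gamma_1}i\,u^{k-1}\,dz,$$ $$Q_2(\tilde m,\tilde\alpha)=\operatorname{Re}\int_{\gamma_2}-i\Big(\frac{1+\tilde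 m\tilde z}{\tilde z}\Big)^2\tilde u^{k+1}\,d\tilde z,\qquad C_2(\tilde\alpha)=\operatorname{Re}\int_{\gamma_2}i\,\tilde u^{k-1}\,d\tilde z.$$ The period compatibility condition for $(m,\alpha)$ is $$\frac{Q_1(m,\alpha)}{Q_2(\tilde m,\tilde\alpha)}=\frac{C_1(\alpha)}{C_2(\tilde\alpha)}\qquad(\text{with }Q_2(\tilde m,\tilde\alpha)\ne0,\ C_2(\tilde\alpha)\neq 0).$$ **Proposition 4.2.** For every $\alpha\in[\pi/4,\pi/2)$ there is a unique real $m=m(\alpha)$ with $0\le m(\alpha)<\cot\alpha$ that satisfies the period compatibility condition, and $m(\alpha)$ is a continuous function of $\alpha\in[\pi/4,\pi/2)$. Moreover, for every such $\alpha$, $m(\alpha)$ satisfies the growth rate condition $$2\tan\alpha+\cot\alpha<\frac1{m(\alpha)}\qquad(\text{where }1/0=+\infty),$$ and the numbers $-(mx+1)$, $m(x+x^{-1})$, $1-mx^{-1}$ with $m=m(\alpha)$, which are the residues at $z=x$, $z=\infty$, $z=-x^{-1}$ of the differential $-\frac{(x+x^{-1})(mz+1)}{(z-x)(z+x^{-1})}\,dz$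 in the $z$-plane (up to a common nonzero factor, the logarithmic growth rates of the bottom, middle and top end), are correctly ordered: $$-(mx+1)<m(x+x^{-1})<1-mx^{-1}.$$ -/

import Mathlib

open Real Set

noncomputable section

namespace ThreeEnded

/-- The Riemann surface with conformal parameter `x = cot α`, away from the points with
`z ∈ {0, ∞}` or `u ∈ {0, ∞}`: all `(z, u)` with
`z⁻¹ - z = (x + x⁻¹) u⁻ᵏ - (x - x⁻¹)`. -/
def surface (k : ℕ) (α : ℝ) : Set (ℂ × ℂ) :=
  {p | p.1 ≠ 0 ∧ p.2 ≠ 0 ∧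
    p.1⁻¹ - p.1 = ((Real.cot α + (Real.cot α)⁻¹ : ℝ) : ℂ) * (p.2 ^ k)⁻¹
      - ((Real.cot α - (Real.cot α)⁻¹ : ℝ) : ℂ)}

/-- Half of the argument of `u ^ k` along the symmetry line `γ₁`: it rises from `0` to `α` for
`s ∈ [0, π/2]`, and falls back to `0` for `s ∈ [π/2, π]`. -/
def phase (α s : ℝ) : ℝ := Real.arcsin (Real.sin α * Real.sin s)

/-- The coordinate `u = exp (i ϕ)` along `γ₁`, where `ϕ` runs from `0` up to `2α/k` and back. -/
def uCoord (k : ℕ) (α s : ℝ) : ℂ := Complex.exp (Complex.I * ((2 * phase α s / k : ℝ) : ℂ))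

/-- The coordinate `z` along `γ₁`: the solution of the surface equation for the given `u` that
starts at `z = sec α - tan α ∈ (0, cot α)`, runs through the upper half plane, passes through the
branch point `z = i` at `s = π/2`, and ends at `z = -(sec α + tan α) < -tan α`. -/
def zCoord (α s : ℝ) : ℂ :=
  (((2 * Real.sin α * Real.cos s : ℝ) : ℂ) * Complex.exp (-(Complex.I * (phase α s : ℂ)))
    - Complex.exp (-(2 * Complex.I * (phase α s : ℂ))) + ((Real.cos (2 * α) : ℝ) : ℂ))
    / ((Real.sin (2 * α) : ℝ) : ℂ)

/-- The symmetry line `γ₁`, parametrized by `s ∈ [0, π]`, with values `(z, u)`. It consists of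
points with `|u| = 1`, and joins the two edges of the fundamental quadrilateral on which
`u > 0` (`0 < z < cot α` and `z < -tan α`). -/
def gamma₁ (k : ℕ) (α s : ℝ) : ℂ × ℂ := (zCoord α s, uCoord k α s)

/-- The substitution `(z, u) ↦ (z̃, ũ) = (-z, exp (iπ/k) u)`; it carries the surface with
parameter `α` to the one with parameter `α̃ = π/2 - α`. -/
def tildeMap (k : ℕ) (p : ℂ × ℂ) : ℂ × ℂ :=
  (-p.1, Complex.exp (Complex.I * ((π / k : ℝ) : ℂ)) * p.2)

/-- The other symmetry line `γ₂` of the quadrilateral, again with values `(z, u)` on the surface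
with parameter `α`. It is the curve which `tildeMap` carries to the line `γ₁` of the surface
with parameter `π/2 - α`. (It is in the half plane `Im z < 0`. Replacing it by its mirror image
under `(z, u) ↦ (conj z, conj u)`, which is in the same quadrilateral as `γ₁`, changes the sign of
both integrals along `γ₂` below, and hence changes nothing in the compatibility condition.) -/
def gamma₂ (k : ℕ) (α s : ℝ) : ℂ × ℂ :=
  (-zCoord (π / 2 - α) s,
    Complex.exp (-(Complex.I * ((π / k : ℝ) : ℂ))) * uCoord k (π / 2 - α) s)

/-- The line integral `∫_γ F(z, u) dz` along a curve `γ = (z, u)` parametrized by `[0, π]`. -/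
def lineIntegral (F : ℂ × ℂ → ℂ) (γ : ℝ → ℂ × ℂ) : ℂ :=
  ∫ s in (0 : ℝ)..π, F (γ s) * deriv (fun t => (γ t).1) s

/-- The coefficient of `dz` in `g₁⁻¹ dh`, where `g₁ = u⁻¹ z / (m z + 1)` and
`dh = uᵏ (m z + 1) dz / z`. -/
def qForm (k : ℕ) (m : ℝ) (p : ℂ × ℂ) : ℂ := ((1 + (m : ℂ) * p.1) / p.1) ^ 2 * p.2 ^ (k + 1)

/-- The coefficient of `dz` in `g₁ dh`. -/
def cForm (k : ℕ) (p : ℂ × ℂ) : ℂ := p.2 ^ (k - 1)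

/-- `Q₁(m, α) = Re ∫_{γ₁} -i g₁⁻¹ dh`. -/
def Q₁ (k : ℕ) (m α : ℝ) : ℝ := (-Complex.I * lineIntegral (qForm k m) (gamma₁ k α)).re

/-- `C₁(α) = Re ∫_{γ₁} i g₁ dh`. -/
def C₁ (k : ℕ) (α : ℝ) : ℝ := (Complex.I * lineIntegral (cForm k) (gamma₁ k α)).re

/-- The quantity `Q₂(m̃, α̃)`, with `m̃ = -m` and `α̃ = π/2 - α`, as a function of `(m, α)`:
the integral along `γ₂` of the form with parameter `m̃` in the coordinates `(z̃, ũ)`. -/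
def Q₂tilde (k : ℕ) (m α : ℝ) : ℝ :=
  (-Complex.I * lineIntegral (qForm k (-m)) (fun s => tildeMap k (gamma₂ k α s))).re

/-- The quantity `C₂(α̃)`, with `α̃ = π/2 - α`, as a function of `α`. -/
def C₂tilde (k : ℕ) (α : ℝ) : ℝ :=
  (Complex.I * lineIntegral (cForm k) (fun s => tildeMap k (gamma₂ k α s))).re

/-- The period compatibility condition `Q₁(m, α) / Q₂(m̃, α̃) = C₁(α) / C₂(α̃)`, in which both
quotients are required to be meaningful. -/
def Compatible (k : ℕ) (m α : ℝ) : Prop :=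
  Q₂tilde k m α ≠ 0 ∧ C₂tilde k α ≠ 0 ∧ Q₁ k m α / Q₂tilde k m α = C₁ k α / C₂tilde k α

/-! Checks that the two curves are the intended ones. -/

theorem sin_phase (α s : ℝ) : Real.sin (phase α s) = Real.sin α * Real.sin s := by
  have h1 := Real.abs_sin_le_one α
  have h2 := Real.abs_sin_le_one s
  have h : |Real.sin α * Real.sin s| ≤ 1 := by
    rw [abs_mul]; exact mul_le_one₀ h1 (abs_nonneg _) h2
  exact Real.sin_arcsin (abs_le.1 h).1 (abs_le.1 h).2

theorem norm_uCoord (k : ℕ) (α s : ℝ) : ‖uCoord k α s‖ = 1 := by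
  unfold uCoord; rw [mul_comm]; exact Complex.norm_exp_ofReal_mul_I _

theorem cos_phase_gt {α s : ℝ} (h0 : 0 < α) (h1 : α < π / 2) :
    |Real.sin α * Real.cos s| < Real.cos (phase α s) := by
  have hc : 0 ≤ Real.cos (phase α s) := Real.cos_arcsin_nonneg _
  have hs := sin_phase α s
  have e := Real.sin_sq_add_cos_sq (phase α s)
  have e2 := Real.sin_sq_add_cos_sq s
  have e3 := Real.sin_sq_add_cos_sq α
  have p : 0 < Real.cos α := Real.cos_pos_of_mem_Ioo ⟨by linarith, h1⟩
  apply abs_lt_of_sq_lt_sq _ hc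
  rw [hs] at e
  have : (Real.sin α * Real.cos s) ^ 2
      = Real.cos (phase α s) ^ 2 - Real.cos α ^ 2 := by
    have e4 : Real.cos s ^ 2 = 1 - Real.sin s ^ 2 := by linarith
    rw [mul_pow, e4]; linear_combination e3 - e
  nlinarith [sq_pos_of_pos p]

theorem zCoord_im (α s : ℝ) : (zCoord α s).im =
    2 * Real.sin (phase α s) * (Real.cos (phase α s) - Real.sin α * Real.cos s)
      / Real.sin (2 * α) := by
  have a1 : -(Complex.I * (phase α s : ℂ)) = ((-phase α s : ℝ) : ℂ) * Complex.I := by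
    push_cast; ring
  have a2 : -(2 * Complex.I * (phase α s : ℂ)) = ((-(2 * phase α s) : ℝ) : ℂ) * Complex.I := by
    push_cast; ring
  unfold zCoord
  rw [Complex.div_ofReal_im, a1, a2, Complex.add_im, Complex.sub_im, Complex.im_ofReal_mul,
    Complex.exp_ofReal_mul_I_im, Complex.exp_ofReal_mul_I_im, Complex.ofReal_im,
    Real.sin_neg, Real.sin_neg, Real.sin_two_mul (phase α s)]
  ring

theorem zCoord_im_pos {α s : ℝ} (h0 : 0 < α) (h1 : α < π / 2) (hs0 : 0 < s) (hs1 : s < π) :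
    0 < (zCoord α s).im := by
  rw [zCoord_im]
  have p1 : 0 < Real.sin α := Real.sin_pos_of_pos_of_lt_pi h0 (by linarith)
  have p2 : 0 < Real.sin s := Real.sin_pos_of_pos_of_lt_pi hs0 hs1
  have p3 : 0 < Real.sin (2 * α) := Real.sin_pos_of_pos_of_lt_pi (by linarith) (by linarith)
  have p4 := (abs_lt.1 (cos_phase_gt (s := s) h0 h1)).2
  rw [sin_phase]
  have : 0 < Real.cos (phase α s) - Real.sin α * Real.cos s := by linarith
  positivity

theorem zCoord_zero {α : ℝ} (h0 : 0 < α) (h1 : α < π / 2) :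
    zCoord α 0 = (((1 - Real.sin α) / Real.cos α : ℝ) : ℂ) := by
  have p1 : Real.sin α ≠ 0 := (Real.sin_pos_of_pos_of_lt_pi h0 (by linarith)).ne'
  have p2 : Real.cos α ≠ 0 := (Real.cos_pos_of_mem_Ioo ⟨by linarith, h1⟩).ne'
  have e : (2 * Real.sin α - 1 + Real.cos (2 * α)) / Real.sin (2 * α)
      = (1 - Real.sin α) / Real.cos α := by
    rw [Real.cos_two_mul, Real.sin_two_mul]
    field_simp
    linear_combination 2 * Real.sin_sq_add_cos_sq α
  rw [← e]
  simp [zCoord, phase]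

theorem zCoord_pi {α : ℝ} (h0 : 0 < α) (h1 : α < π / 2) :
    zCoord α π = ((-((1 + Real.sin α) / Real.cos α) : ℝ) : ℂ) := by
  have p1 : Real.sin α ≠ 0 := (Real.sin_pos_of_pos_of_lt_pi h0 (by linarith)).ne'
  have p2 : Real.cos α ≠ 0 := (Real.cos_pos_of_mem_Ioo ⟨by linarith, h1⟩).ne'
  have e : (-(2 * Real.sin α) - 1 + Real.cos (2 * α)) / Real.sin (2 * α)
      = -((1 + Real.sin α) / Real.cos α) := by
    rw [Real.cos_two_mul, Real.sin_two_mul]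
    field_simp
    linear_combination 2 * Real.sin_sq_add_cos_sq α
  rw [← e]
  simp [zCoord, phase]

theorem uCoord_zero (k : ℕ) (α : ℝ) : uCoord k α 0 = 1 ∧ uCoord k α π = 1 := by
  simp [uCoord, phase]

theorem tildeMap_gamma₂ (k : ℕ) (α s : ℝ) :
    tildeMap k (gamma₂ k α s) = gamma₁ k (π / 2 - α) s := by
  unfold tildeMap gamma₂ gamma₁
  rw [← mul_assoc, ← Complex.exp_add, add_neg_cancel, Complex.exp_zero, one_mul, neg_neg]

theorem cot_add_inv {α : ℝ} (h0 : 0 < α) (h1 : α < π / 2) :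
    Real.cot α + (Real.cot α)⁻¹ = 2 / Real.sin (2 * α) ∧
      Real.cot α - (Real.cot α)⁻¹ = 2 * Real.cos (2 * α) / Real.sin (2 * α) := by
  have p1 : Real.sin α ≠ 0 := (Real.sin_pos_of_pos_of_lt_pi h0 (by linarith)).ne'
  have p2 : Real.cos α ≠ 0 := (Real.cos_pos_of_mem_Ioo ⟨by linarith, h1⟩).ne'
  rw [Real.cot_eq_cos_div_sin, Real.cos_two_mul, Real.sin_two_mul, inv_div]
  constructor
  · field_simp
    linear_combination Real.sin_sq_add_cos_sq α
  · field_simp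
    linear_combination -Real.sin_sq_add_cos_sq α

theorem uCoord_pow_inv {k : ℕ} (hk : k ≠ 0) (α s : ℝ) :
    (uCoord k α s ^ k)⁻¹ = Complex.exp (-(Complex.I * (phase α s : ℂ))) ^ 2 := by
  have hk' : (k : ℂ) ≠ 0 := Nat.cast_ne_zero.2 hk
  unfold uCoord
  rw [← Complex.exp_nat_mul, ← Complex.exp_nat_mul, ← Complex.exp_neg]
  congr 1
  push_cast
  field_simp

theorem gamma₁_mem_surface {k : ℕ} (hk : k ≠ 0) {α : ℝ} (h0 : 0 < α) (h1 : α < π / 2) (s : ℝ) :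
    gamma₁ k α s ∈ surface k α := by
  have p3 : Real.sin (2 * α) ≠ 0 :=
    (Real.sin_pos_of_pos_of_lt_pi (by linarith) (by linarith)).ne'
  have p3' : ((Real.sin (2 * α) : ℝ) : ℂ) ≠ 0 := Complex.ofReal_ne_zero.2 p3
  obtain ⟨c1, c2⟩ := cot_add_inv h0 h1
  have hu := uCoord_pow_inv hk α s
  set w := Complex.exp (-(Complex.I * (phase α s : ℂ))) with hw
  have hw0 : w ≠ 0 := Complex.exp_ne_zero _
  have hw2 : Complex.exp (-(2 * Complex.I * (phase α s : ℂ))) = w ^ 2 := by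
    rw [hw, ← Complex.exp_nat_mul]; congr 1; push_cast; ring
  have hz : zCoord α s = (((2 * Real.sin α * Real.cos s : ℝ) : ℂ) * w - w ^ 2
      + ((Real.cos (2 * α) : ℝ) : ℂ)) / ((Real.sin (2 * α) : ℝ) : ℂ) := by
    rw [← hw2]; rfl
  have hcos : w + w⁻¹ = ((2 * Real.cos (phase α s) : ℝ) : ℂ) := by
    rw [hw, ← Complex.exp_neg, neg_neg, Complex.ofReal_mul, Complex.ofReal_cos, Complex.cos]
    push_cast
    rw [mul_comm Complex.I, neg_mul]
    ring
  have hkey : w ^ 4 + 1 - 2 * ((Real.cos (2 * α) : ℝ) : ℂ) * w ^ 2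
      = ((2 * Real.sin α * Real.cos s : ℝ) : ℂ) ^ 2 * w ^ 2 := by
    have r : (2 * Real.cos (phase α s)) ^ 2 - 2 - 2 * Real.cos (2 * α)
        = (2 * Real.sin α * Real.cos s) ^ 2 := by
      have e := Real.sin_sq_add_cos_sq (phase α s)
      rw [sin_phase] at e
      rw [Real.cos_two_mul]
      linear_combination 4 * e - 4 * Real.sin_sq_add_cos_sq α
        - 4 * Real.sin α ^ 2 * (Real.sin_sq_add_cos_sq s)
    rw [← Complex.ofReal_pow, ← r, Complex.ofReal_sub, Complex.ofReal_sub, Complex.ofReal_pow,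
      ← hcos]
    push_cast
    field_simp
    ring
  have hcs : ((Real.cos (2 * α) : ℝ) : ℂ) ^ 2 + ((Real.sin (2 * α) : ℝ) : ℂ) ^ 2 = 1 := by
    rw [← Complex.ofReal_pow, ← Complex.ofReal_pow, ← Complex.ofReal_add,
      Real.cos_sq_add_sin_sq, Complex.ofReal_one]
  have hprod : zCoord α s * ((((2 * Real.sin α * Real.cos s : ℝ) : ℂ) * w + w ^ 2
      - ((Real.cos (2 * α) : ℝ) : ℂ)) / ((Real.sin (2 * α) : ℝ) : ℂ)) = 1 := by
    rw [hz, div_mul_div_comm, div_eq_one_iff_eq (mul_ne_zero p3' p3')]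
    linear_combination -hkey - hcs
  have hz0 : zCoord α s ≠ 0 := left_ne_zero_of_mul_eq_one hprod
  refine ⟨hz0, Complex.exp_ne_zero _, ?_⟩
  show (zCoord α s)⁻¹ - zCoord α s = _ * (uCoord k α s ^ k)⁻¹ - _
  rw [hu, c1, c2, inv_eq_of_mul_eq_one_right hprod, hz, Complex.ofReal_div, Complex.ofReal_div,
    Complex.ofReal_mul 2 (Real.cos (2 * α)), Complex.ofReal_ofNat]
  ring

theorem gamma₂_mem_surface {k : ℕ} (hk : k ≠ 0) {α : ℝ} (h0 : 0 < α) (h1 : α < π / 2) (s : ℝ) :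
    gamma₂ k α s ∈ surface k α := by
  obtain ⟨a, b, e⟩ := gamma₁_mem_surface hk (α := π / 2 - α) (by linarith) (by linarith) s
  have hc : Real.cot (π / 2 - α) = (Real.cot α)⁻¹ := by
    rw [Real.cot_inv_eq_tan, Real.cot_eq_cos_div_sin, Real.cos_pi_div_two_sub,
      Real.sin_pi_div_two_sub, Real.tan_eq_sin_div_cos]
  have hk' : (k : ℂ) ≠ 0 := Nat.cast_ne_zero.2 hk
  have hexp : Complex.exp (-(Complex.I * ((π / k : ℝ) : ℂ))) ^ k = -1 := by
    rw [← Complex.exp_nat_mul]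
    have : (k : ℂ) * -(Complex.I * ((π / k : ℝ) : ℂ)) = -(π * Complex.I) := by
      push_cast; field_simp
    rw [this, Complex.exp_neg, Complex.exp_pi_mul_I]
    norm_num
  refine ⟨neg_ne_zero.2 a, mul_ne_zero (Complex.exp_ne_zero _) b, ?_⟩
  rw [hc, inv_inv] at e
  change (zCoord (π / 2 - α) s)⁻¹ - zCoord (π / 2 - α) s = _ at e
  show (-zCoord (π / 2 - α) s)⁻¹ - (-zCoord (π / 2 - α) s) = _
  have e' : (gamma₁ k (π / 2 - α) s).2 = uCoord k (π / 2 - α) s := rfl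
  rw [e'] at e
  show _ = _ * ((Complex.exp (-(Complex.I * ((π / k : ℝ) : ℂ))) * uCoord k (π / 2 - α) s) ^ k)⁻¹ - _
  rw [mul_pow, hexp, neg_one_mul, inv_neg, inv_neg]
  push_cast at e ⊢
  linear_combination -e

end ThreeEnded

end

noncomputable section

namespace ThreeEnded

/-! ### Calculus along the curve -/

/-! Write `ϕ = phase α s` and `b = 2/k`, so that `0 < b ≤ 1`. Since `sin ϕ = sin α sin s`, the
parameter `s` resolves the branch point `z = i`: along `γ₁` one has `dz/z = i e^{-iϕ} ds / cos ϕ`,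
which is smooth. All periods then become combinations of two real integrals over `[0, π]`, `E = ∫
cos(bϕ)` (`cosInt`) and `F = ∫ sin(bϕ) tan ϕ` (`sinTanInt`); see `Q₁_eq` and `C₁_eq`. The periods
along `γ₂` are those along `γ₁` for `(-m, π/2 - α)`, with integrals `E'`, `F'`.

With `a = sin α` and `c = cos α`, cross-multiplying the compatibility condition gives a quadratic
equation `A m² + B m - A = 0` (`compatible_iff`). If `A ≥ 0` and `B > 0`, the left side is strictly
increasing for `m ≥ 0` and has exactly one root there, depending continuously on `α`. Everything
else is an inequality between the four integrals, of which two are needed.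

The first is `F cos α ≤ E (1 - cos α)` (`sinTanInt_mul_cos_le`). At `α` and at `π/2 - α` it gives `B
> 0`. At `π/2 - α` it also makes the quadratic positive at `ac / (1 + a²)`, which is `1 / (2 tan α +
cot α)`. The root therefore lies below this number, which is the growth rate condition and also
implies `m < cot α`, the order of the residues and `Q₂ ≠ 0`.

The second says that `F / (E tan² α)` is antitone in `α` (`sinTanInt_mul_cosInt_le`). Comparing `π/2
- α ≤ α` gives `A ≥ 0`; this is where `α ≥ π/4` enters. Both inequalities combine pointwise bounds
with a weighted Chebyshev inequality, using that everything in sight is monotone in `sin s`. -/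

theorem abs_sin_mul_sin_lt_one {α : ℝ} (h0 : 0 < α) (h1 : α < π / 2) (s : ℝ) :
    |Real.sin α * Real.sin s| < 1 := by
  have p : 0 < Real.cos α := Real.cos_pos_of_mem_Ioo ⟨by linarith, h1⟩
  have e := Real.sin_sq_add_cos_sq α
  have e2 := Real.sin_sq_add_cos_sq s
  rw [← sq_lt_one_iff_abs_lt_one]
  nlinarith [sq_pos_of_pos p, sq_nonneg (Real.sin s), sq_nonneg (Real.cos s),
    mul_nonneg (sq_nonneg (Real.sin α)) (sq_nonneg (Real.cos s))]

theorem cos_phase_pos {α : ℝ} (h0 : 0 < α) (h1 : α < π / 2) (s : ℝ) :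
    0 < Real.cos (phase α s) :=
  (abs_nonneg _).trans_lt (cos_phase_gt h0 h1)

theorem continuous_phase : Continuous fun q : ℝ × ℝ => phase q.1 q.2 := by
  unfold phase; fun_prop

theorem continuous_phase_right (α : ℝ) : Continuous fun s => phase α s := by
  unfold phase; fun_prop

theorem hasDerivAt_phase {α : ℝ} (h0 : 0 < α) (h1 : α < π / 2) (s : ℝ) :
    HasDerivAt (phase α) (Real.sin α * Real.cos s / Real.cos (phase α s)) s := by
  have h := abs_lt.1 (abs_sin_mul_sin_lt_one h0 h1 s)
  have d := (Real.hasDerivAt_arcsin h.1.ne' h.2.ne).comp s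
    ((Real.hasDerivAt_sin s).const_mul (Real.sin α))
  have e : Real.cos (phase α s) = √(1 - (Real.sin α * Real.sin s) ^ 2) := Real.cos_arcsin _
  rw [e]
  exact d.congr_deriv (by ring)

/-- Differentiating the surface equation gives `dz/z = i e^{-iϕ} dϕ / (sin α cos s)`. Since `cos ϕ
dϕ = sin α cos s ds`, the factor vanishing at the branch point cancels. -/
theorem hasDerivAt_zCoord {α : ℝ} (h0 : 0 < α) (h1 : α < π / 2) (s : ℝ) :
    HasDerivAt (zCoord α)
      (zCoord α s * (Complex.I * Complex.exp (-(Complex.I * (phase α s : ℂ)))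
        / (Real.cos (phase α s) : ℂ))) s := by
  have hp := (hasDerivAt_phase h0 h1 s).ofReal_comp
  have hc := (cos_phase_pos h0 h1 s).ne'
  have hc' : ((Real.cos (phase α s) : ℝ) : ℂ) ≠ 0 := Complex.ofReal_ne_zero.2 hc
  have p3 : Real.sin (2 * α) ≠ 0 :=
    (Real.sin_pos_of_pos_of_lt_pi (by linarith) (by linarith)).ne'
  have p3' : ((Real.sin (2 * α) : ℝ) : ℂ) ≠ 0 := Complex.ofReal_ne_zero.2 p3
  have hcos := ((Real.hasDerivAt_cos s).const_mul (2 * Real.sin α)).ofReal_comp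
  have he1 := (hp.const_mul Complex.I).neg.cexp
  have he2 := (hp.const_mul (2 * Complex.I)).neg.cexp
  have d := ((((hcos.mul he1).sub he2).add_const ((Real.cos (2 * α) : ℝ) : ℂ)).div_const
    ((Real.sin (2 * α) : ℝ) : ℂ))
  refine d.congr_deriv ?_
  have hw2 : Complex.exp (-(2 * Complex.I * (phase α s : ℂ)))
      = Complex.exp (-(Complex.I * (phase α s : ℂ))) ^ 2 := by
    rw [← Complex.exp_nat_mul]; congr 1; push_cast; ring
  have hw : Complex.exp (-(Complex.I * (phase α s : ℂ)))
      = (Real.cos (phase α s) : ℂ) - (Real.sin (phase α s) : ℂ) * Complex.I := by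
    have : -(Complex.I * (phase α s : ℂ)) = ((-phase α s : ℝ) : ℂ) * Complex.I := by
      push_cast; ring
    rw [this, Complex.exp_mul_I, ← Complex.ofReal_cos, ← Complex.ofReal_sin, Real.cos_neg,
      Real.sin_neg]
    push_cast; ring
  have e1 : ((Real.sin (phase α s) : ℝ) : ℂ) = (Real.sin α : ℂ) * (Real.sin s : ℂ) := by
    rw [sin_phase]; push_cast; rfl
  have e2 : ((Real.sin (phase α s) : ℝ) : ℂ) ^ 2 + ((Real.cos (phase α s) : ℝ) : ℂ) ^ 2 = 1 := by
    exact_mod_cast Real.sin_sq_add_cos_sq (phase α s)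
  have e3 : ((Real.sin s : ℝ) : ℂ) ^ 2 + ((Real.cos s : ℝ) : ℂ) ^ 2 = 1 := by
    exact_mod_cast Real.sin_sq_add_cos_sq s
  have e4 : ((Real.cos (2 * α) : ℝ) : ℂ) = 1 - 2 * (Real.sin α : ℂ) ^ 2 := by
    rw [Real.cos_two_mul, Real.cos_sq']; push_cast; ring
  unfold zCoord
  simp only [Pi.neg_apply, hw2, hw, e4]
  rw [Complex.ofReal_div]
  simp only [Complex.ofReal_mul, Complex.ofReal_neg, Complex.ofReal_ofNat]
  -- What remains is a polynomial identity modulo `S = a y`, the two Pythagorean relations and `I² =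
  -- -1`.
  generalize ((Real.sin (phase α s) : ℝ) : ℂ) = S at *
  generalize ((Real.cos (phase α s) : ℝ) : ℂ) = C at *
  generalize ((Real.sin α : ℝ) : ℂ) = a at *
  generalize ((Real.sin s : ℝ) : ℂ) = y at *
  generalize ((Real.cos s : ℝ) : ℂ) = x at *
  generalize ((Real.sin (2 * α) : ℝ) : ℂ) = σ at *
  have hI := Complex.I_sq
  field_simp
  linear_combination (C - S * Complex.I) * ((2 * C - 2 * Complex.I * (S + a * y)) * e1
    + (Complex.I * S ^ 2 - 2 * S * C) * hI + Complex.I * e2 - 2 * Complex.I * a ^ 2 * e3)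

/-! ### Evaluation of the periods -/

/-- The integral of `cos (b ϕ)` along the curve on which `ϕ = phase α`. -/
def cosInt (b α : ℝ) : ℝ := ∫ s in (0 : ℝ)..π, Real.cos (b * phase α s)

/-- The integral of `sin (b ϕ) tan ϕ` along the curve on which `ϕ = phase α`. -/
def sinTanInt (b α : ℝ) : ℝ :=
  ∫ s in (0 : ℝ)..π, Real.sin (b * phase α s) * Real.tan (phase α s)

theorem continuous_tan_phase {α : ℝ} (h0 : 0 < α) (h1 : α < π / 2) :
    Continuous fun s => Real.tan (phase α s) := by
  have h := continuous_phase_right α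
  simp only [Real.tan_eq_sin_div_cos]
  exact (Real.continuous_sin.comp h).div (Real.continuous_cos.comp h)
    fun s => (cos_phase_pos h0 h1 s).ne'

theorem phase_pi_sub (α s : ℝ) : phase α (π - s) = phase α s := by
  unfold phase; rw [Real.sin_pi_sub]

theorem integral_eq_zero_of_antisymm {f : ℝ → ℝ} (h : ∀ s, f (π - s) = -f s) :
    ∫ s in (0 : ℝ)..π, f s = 0 := by
  have e := intervalIntegral.integral_comp_sub_left (a := 0) (b := π) f π
  simp only [h, sub_self, sub_zero, intervalIntegral.integral_neg] at e
  linarith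

theorem re_intervalIntegral {f : ℝ → ℂ} (hf : Continuous f) (a b : ℝ) :
    (∫ s in a..b, f s).re = ∫ s in a..b, (f s).re :=
  (Complex.reCLM.intervalIntegral_comp_comm (hf.intervalIntegrable a b)).symm

/-- The phase is symmetric under `s ↦ π - s` while `cos s` changes sign, so the `A` term integrates
to zero. The real parts of the period integrands all have this shape. -/
theorem integral_odd_add_combination {α : ℝ} (h0 : 0 < α) (h1 : α < π / 2) (b A B C : ℝ) :
    ∫ s in (0 : ℝ)..π, (A * (Real.cos s * Real.cos (b * phase α s) / Real.cos (phase α s))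
      + (B * Real.cos (b * phase α s) + C * (Real.sin (b * phase α s) * Real.tan (phase α s))))
      = B * cosInt b α + C * sinTanInt b α := by
  have hp := continuous_phase_right α
  have ht := continuous_tan_phase h0 h1
  have hb : Continuous fun s => b * phase α s := continuous_const.mul hp
  have c2 : Continuous fun s => Real.cos (b * phase α s) := Real.continuous_cos.comp hb
  have c1 : Continuous fun s => Real.cos s * Real.cos (b * phase α s) / Real.cos (phase α s) :=
    (Real.continuous_cos.mul c2).div (Real.continuous_cos.comp hp)
      fun s => (cos_phase_pos h0 h1 s).ne'
  have c3 : Continuous fun s => Real.sin (b * phase α s) * Real.tan (phase α s) :=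
    (Real.continuous_sin.comp hb).mul ht
  have d1 := (c1.const_mul A).intervalIntegrable (μ := MeasureTheory.volume) 0 π
  have d2 := (c2.const_mul B).intervalIntegrable (μ := MeasureTheory.volume) 0 π
  have d3 := (c3.const_mul C).intervalIntegrable (μ := MeasureTheory.volume) 0 π
  rw [intervalIntegral.integral_add d1 (d2.add d3), intervalIntegral.integral_add d2 d3,
    intervalIntegral.integral_const_mul, intervalIntegral.integral_const_mul,
    intervalIntegral.integral_const_mul, integral_eq_zero_of_antisymm (f := fun s =>
      Real.cos s * Real.cos (b * phase α s) / Real.cos (phase α s))]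
  · rw [mul_zero, zero_add]; rfl
  · intro s
    rw [phase_pi_sub, Real.cos_pi_sub]; ring

/-- The factor `exp (i x)` in terms of real functions. -/
def cis (x : ℝ) : ℂ := (Real.cos x : ℂ) + (Real.sin x : ℂ) * Complex.I

theorem cis_eq (x : ℝ) : cis x = Complex.exp (Complex.I * x) := by
  rw [cis, mul_comm Complex.I, Complex.exp_mul_I, Complex.ofReal_cos, Complex.ofReal_sin]

theorem cis_mul_cis_neg (x : ℝ) : cis x * cis (-x) = 1 := by
  rw [cis_eq, cis_eq, ← Complex.exp_add]; simp

theorem continuous_cis : Continuous cis := by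
  unfold cis; fun_prop

theorem uCoord_eq_cis (k : ℕ) (α s : ℝ) : uCoord k α s = cis (2 / k * phase α s) := by
  rw [cis_eq, uCoord]; congr 3; ring

theorem uCoord_pow {k : ℕ} (hk : k ≠ 0) (α s : ℝ) :
    uCoord k α s ^ k = cis (phase α s) ^ 2 := by
  rw [← inv_inj, uCoord_pow_inv hk, ← inv_pow, cis_eq, Complex.exp_neg]

theorem zCoord_eq_cis (α s : ℝ) :
    zCoord α s = (((2 * Real.sin α * Real.cos s : ℝ) : ℂ) * cis (-phase α s)
      - cis (-phase α s) ^ 2 + ((Real.cos (2 * α) : ℝ) : ℂ)) / ((Real.sin (2 * α) : ℝ) : ℂ) := by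
  have e : cis (-phase α s) ^ 2 = Complex.exp (-(2 * Complex.I * (phase α s : ℂ))) := by
    rw [cis_eq, ← Complex.exp_nat_mul]; congr 1; push_cast; ring
  have e' : cis (-phase α s) = Complex.exp (-(Complex.I * (phase α s : ℂ))) := by
    rw [cis_eq]; congr 1; push_cast; ring
  rw [e, e']; rfl

theorem zCoord_ne_zero {α : ℝ} (h0 : 0 < α) (h1 : α < π / 2) (s : ℝ) : zCoord α s ≠ 0 :=
  (gamma₁_mem_surface one_ne_zero h0 h1 s).1

/-- The two roots of the surface equation for given `u` have product `-1`, so inversion only flips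
the sign of the part without `cos s`. As `z` does not involve `k`, the surface with `k = 1` can be
used. -/
theorem zCoord_inv {α : ℝ} (h0 : 0 < α) (h1 : α < π / 2) (s : ℝ) :
    (zCoord α s)⁻¹ = (((2 * Real.sin α * Real.cos s : ℝ) : ℂ) * cis (-phase α s)
      + cis (-phase α s) ^ 2 - ((Real.cos (2 * α) : ℝ) : ℂ)) / ((Real.sin (2 * α) : ℝ) : ℂ) := by
  have h := (gamma₁_mem_surface one_ne_zero h0 h1 s).2.2
  obtain ⟨c1, c2⟩ := cot_add_inv h0 h1
  change (zCoord α s)⁻¹ - zCoord α s = _ * (uCoord 1 α s ^ 1)⁻¹ - _ at h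
  have e' : cis (-phase α s) = Complex.exp (-(Complex.I * (phase α s : ℂ))) := by
    rw [cis_eq]; congr 1; push_cast; ring
  rw [uCoord_pow_inv one_ne_zero, c1, c2, ← e'] at h
  rw [eq_add_of_sub_eq h, zCoord_eq_cis]
  push_cast
  ring

theorem deriv_zCoord {α : ℝ} (h0 : 0 < α) (h1 : α < π / 2) (s : ℝ) :
    deriv (zCoord α) s
      = zCoord α s * (Complex.I * cis (-phase α s) / (Real.cos (phase α s) : ℂ)) := by
  have e' : cis (-phase α s) = Complex.exp (-(Complex.I * (phase α s : ℂ))) := by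
    rw [cis_eq]; congr 1; push_cast; ring
  rw [(hasDerivAt_zCoord h0 h1 s).deriv, e']

theorem one_sub_cos_two_mul (α : ℝ) : 1 - Real.cos (2 * α) = 2 * Real.sin α ^ 2 := by
  rw [Real.cos_two_mul, Real.cos_sq']; ring

theorem one_add_cos_two_mul (α : ℝ) : 1 + Real.cos (2 * α) = 2 * Real.cos α ^ 2 := by
  rw [Real.cos_two_mul]; ring

/-- By the formula for `dz/z` the integrand is `(z⁻¹ + 2m + m² z) u e^{iϕ} / cos ϕ`. In `z⁻¹ + m² z`
the `cos s` parts add up with weight `1 + m²` and integrate to zero; the other parts carry `1 - m²`,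
and `1 ∓ cos 2α` yields the squares of sine and cosine. -/
theorem Q₁_eq {k : ℕ} (hk : k ≠ 0) {α : ℝ} (h0 : 0 < α) (h1 : α < π / 2) (m : ℝ) :
    Q₁ k m α = (2 / Real.sin (2 * α)) *
      ((1 - m ^ 2) * (Real.sin α ^ 2 * cosInt (2 / k) α + Real.cos α ^ 2 * sinTanInt (2 / k) α)
        + 2 * m * Real.sin α * Real.cos α * (cosInt (2 / k) α - sinTanInt (2 / k) α)) := by
  have p3 : Real.sin (2 * α) ≠ 0 :=
    (Real.sin_pos_of_pos_of_lt_pi (by linarith) (by linarith)).ne'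
  have p3' : ((Real.sin (2 * α) : ℝ) : ℂ) ≠ 0 := Complex.ofReal_ne_zero.2 p3
  set G : ℝ → ℂ := fun s => (cis (2 / k * phase α s) *
    (((1 + m ^ 2) * (2 * Real.sin α * Real.cos s) : ℝ)
      + ((1 - m ^ 2 : ℝ) : ℂ) * (cis (-phase α s) - (Real.cos (2 * α) : ℝ) * cis (phase α s))
      + ((2 * m * Real.sin (2 * α) : ℝ) : ℂ) * cis (phase α s)))
    / ((Real.sin (2 * α) * Real.cos (phase α s) : ℝ) : ℂ) with hG
  have hint : ∀ s, -Complex.I * (qForm k m (gamma₁ k α s)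
      * deriv (fun t => (gamma₁ k α t).1) s) = G s := by
    intro s
    have hz := zCoord_ne_zero h0 h1 s
    have hC : ((Real.cos (phase α s) : ℝ) : ℂ) ≠ 0 :=
      Complex.ofReal_ne_zero.2 (cos_phase_pos h0 h1 s).ne'
    have hw := cis_mul_cis_neg (phase α s)
    have e1 : -Complex.I * (qForm k m (gamma₁ k α s) * deriv (fun t => (gamma₁ k α t).1) s)
        = ((zCoord α s)⁻¹ + 2 * m + m ^ 2 * zCoord α s) * uCoord k α s * cis (phase α s) ^ 2
          * cis (-phase α s) / (Real.cos (phase α s) : ℂ) := by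
      change -Complex.I * (((1 + (m : ℂ) * zCoord α s) / zCoord α s) ^ 2 * uCoord k α s ^ (k + 1)
        * deriv (zCoord α) s) = _
      rw [deriv_zCoord h0 h1, pow_succ (uCoord k α s), uCoord_pow hk]
      field_simp
      rw [Complex.I_sq]
      ring
    rw [e1, zCoord_inv h0 h1, zCoord_eq_cis, uCoord_eq_cis, hG]
    simp only [Complex.ofReal_mul, Complex.ofReal_add, Complex.ofReal_sub, Complex.ofReal_pow,
      Complex.ofReal_one, Complex.ofReal_ofNat]
    generalize cis (2 / k * phase α s) = u
    generalize cis (phase α s) = v at *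
    generalize cis (-phase α s) = w at *
    have hw0 : w ≠ 0 := right_ne_zero_of_mul_eq_one hw
    rw [eq_inv_of_mul_eq_one_left hw]
    field_simp
    ring
  have hre : ∀ s, (G s).re = (1 + m ^ 2) * (2 * Real.sin α) / Real.sin (2 * α)
        * (Real.cos s * Real.cos (2 / k * phase α s) / Real.cos (phase α s))
      + ((2 / Real.sin (2 * α) *
          ((1 - m ^ 2) * Real.sin α ^ 2 + 2 * m * Real.sin α * Real.cos α))
          * Real.cos (2 / k * phase α s)
        + (2 / Real.sin (2 * α) *
          ((1 - m ^ 2) * Real.cos α ^ 2 - 2 * m * Real.sin α * Real.cos α))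
          * (Real.sin (2 / k * phase α s) * Real.tan (phase α s))) := by
    intro s
    have hC := (cos_phase_pos h0 h1 s).ne'
    have hs := Real.sin_two_mul α
    have hκ := one_sub_cos_two_mul α
    have hκ' := one_add_cos_two_mul α
    rw [hG]
    simp only [Complex.div_ofReal_re]
    simp only [cis, Real.cos_neg, Real.sin_neg, Complex.mul_re, Complex.add_re, Complex.add_im,
      Complex.sub_re, Complex.sub_im, Complex.ofReal_re, Complex.ofReal_im, Complex.mul_im,
      Complex.I_re, Complex.I_im, Real.tan_eq_sin_div_cos]
    generalize Real.cos (2 / k * phase α s) = x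
    generalize Real.sin (2 / k * phase α s) = y
    field_simp
    linear_combination x * Real.cos (phase α s) * (1 - m ^ 2) * hκ
      + y * Real.sin (phase α s) * (1 - m ^ 2) * hκ'
      + 2 * m * (x * Real.cos (phase α s) - y * Real.sin (phase α s)) * hs
  have hcont : Continuous G := by
    have hp := continuous_phase_right α
    have hd : Continuous fun s => ((Real.sin (2 * α) * Real.cos (phase α s) : ℝ) : ℂ) := by
      fun_prop
    have c := continuous_cis
    refine Continuous.div (by fun_prop) hd fun s =>
      Complex.ofReal_ne_zero.2 (mul_ne_zero p3 (cos_phase_pos h0 h1 s).ne')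
  rw [Q₁, lineIntegral, ← intervalIntegral.integral_const_mul, funext hint,
    re_intervalIntegral hcont, funext hre, integral_odd_add_combination h0 h1]
  ring

theorem C₁_eq {k : ℕ} (hk : k ≠ 0) {α : ℝ} (h0 : 0 < α) (h1 : α < π / 2) :
    C₁ k α = (2 / Real.sin (2 * α)) *
      (Real.sin α ^ 2 * cosInt (2 / k) α - Real.cos α ^ 2 * sinTanInt (2 / k) α) := by
  have p3 : Real.sin (2 * α) ≠ 0 :=
    (Real.sin_pos_of_pos_of_lt_pi (by linarith) (by linarith)).ne'
  have p3' : ((Real.sin (2 * α) : ℝ) : ℂ) ≠ 0 := Complex.ofReal_ne_zero.2 p3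
  set G : ℝ → ℂ := fun s => (cis (-(2 / k * phase α s)) *
    (-((2 * Real.sin α * Real.cos s : ℝ) : ℂ)
      + cis (-phase α s) - (Real.cos (2 * α) : ℝ) * cis (phase α s)))
    / ((Real.sin (2 * α) * Real.cos (phase α s) : ℝ) : ℂ) with hG
  have hint : ∀ s, Complex.I * (cForm k (gamma₁ k α s)
      * deriv (fun t => (gamma₁ k α t).1) s) = G s := by
    intro s
    have hC : ((Real.cos (phase α s) : ℝ) : ℂ) ≠ 0 :=
      Complex.ofReal_ne_zero.2 (cos_phase_pos h0 h1 s).ne'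
    have hw := cis_mul_cis_neg (phase α s)
    -- Here `u^(k-1)` is split as `u^k u⁻¹`, so that `k` survives only through `2/k`.
    have hu : uCoord k α s ^ (k - 1) = cis (phase α s) ^ 2 * cis (-(2 / k * phase α s)) := by
      rw [← uCoord_pow hk, ← pow_sub_one_mul hk (uCoord k α s), uCoord_eq_cis, mul_assoc,
        cis_mul_cis_neg, mul_one]
    change Complex.I * (uCoord k α s ^ (k - 1) * deriv (zCoord α) s) = _
    rw [deriv_zCoord h0 h1, hu, zCoord_eq_cis, hG]
    simp only [Complex.ofReal_mul, Complex.ofReal_ofNat]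
    generalize cis (-(2 / k * phase α s)) = u
    generalize cis (phase α s) = v at *
    generalize cis (-phase α s) = w at *
    have hw0 : w ≠ 0 := right_ne_zero_of_mul_eq_one hw
    rw [eq_inv_of_mul_eq_one_left hw]
    field_simp
    rw [Complex.I_sq]
    ring
  have hre : ∀ s, (G s).re = -(2 * Real.sin α) / Real.sin (2 * α)
        * (Real.cos s * Real.cos (2 / k * phase α s) / Real.cos (phase α s))
      + ((2 / Real.sin (2 * α) * Real.sin α ^ 2) * Real.cos (2 / k * phase α s)
        + (-(2 / Real.sin (2 * α) * Real.cos α ^ 2))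
          * (Real.sin (2 / k * phase α s) * Real.tan (phase α s))) := by
    intro s
    have hC := (cos_phase_pos h0 h1 s).ne'
    have hκ := one_sub_cos_two_mul α
    have hκ' := one_add_cos_two_mul α
    rw [hG]
    simp only [Complex.div_ofReal_re]
    simp only [cis, Real.cos_neg, Real.sin_neg, Complex.mul_re, Complex.add_re, Complex.add_im,
      Complex.sub_re, Complex.sub_im, Complex.ofReal_re, Complex.ofReal_im, Complex.mul_im,
      Complex.I_re, Complex.I_im, Real.tan_eq_sin_div_cos, Complex.neg_re, Complex.neg_im]
    generalize Real.cos (2 / k * phase α s) = x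
    generalize Real.sin (2 / k * phase α s) = y
    field_simp
    linear_combination x * Real.cos (phase α s) * hκ - y * Real.sin (phase α s) * hκ'
  have hcont : Continuous G := by
    have hp := continuous_phase_right α
    have hd : Continuous fun s => ((Real.sin (2 * α) * Real.cos (phase α s) : ℝ) : ℂ) := by
      fun_prop
    have c := continuous_cis
    refine Continuous.div (by fun_prop) hd fun s =>
      Complex.ofReal_ne_zero.2 (mul_ne_zero p3 (cos_phase_pos h0 h1 s).ne')
  rw [C₁, lineIntegral, ← intervalIntegral.integral_const_mul, funext hint,
    re_intervalIntegral hcont, funext hre, integral_odd_add_combination h0 h1]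
  ring

theorem Q₂tilde_eq_Q₁ (k : ℕ) (m α : ℝ) : Q₂tilde k m α = Q₁ k (-m) (π / 2 - α) := by
  unfold Q₂tilde Q₁
  rw [show (fun s => tildeMap k (gamma₂ k α s)) = gamma₁ k (π / 2 - α) from
    funext (tildeMap_gamma₂ k α)]

theorem C₂tilde_eq_C₁ (k : ℕ) (α : ℝ) : C₂tilde k α = C₁ k (π / 2 - α) := by
  unfold C₂tilde C₁
  rw [show (fun s => tildeMap k (gamma₂ k α s)) = gamma₁ k (π / 2 - α) from
    funext (tildeMap_gamma₂ k α)]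

/-! ### Chebyshev's inequality with two weights -/

/-- Integrating the nonnegative expression in `H` over the square gives twice the difference of the
two sides. In the applications `h` increases with `sin s` while `w / v` decreases. -/
theorem integral_mul_integral_le_of_weights {a b : ℝ} (hab : a ≤ b) {h v w : ℝ → ℝ}
    (hh : Continuous h) (hv : Continuous v) (hw : Continuous w)
    (H : ∀ s ∈ Icc a b, ∀ t ∈ Icc a b, 0 ≤ (h s - h t) * (v s * w t - w s * v t)) :
    (∫ s in a..b, w s * h s) * (∫ s in a..b, v s) ≤
      (∫ s in a..b, v s * h s) * ∫ s in a..b, w s := by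
  set V := ∫ s in a..b, v s
  set W := ∫ s in a..b, w s
  set Vh := ∫ s in a..b, v s * h s
  set Wh := ∫ s in a..b, w s * h s
  have i {f : ℝ → ℝ} (hf : Continuous f) : IntervalIntegrable f MeasureTheory.volume a b :=
    hf.intervalIntegrable a b
  have inner : ∀ s, ∫ t in a..b, (h s - h t) * (v s * w t - w s * v t)
      = (v s * h s * W - w s * h s * V) - (v s * Wh - w s * Vh) := by
    intro s
    have e : ∀ t, (h s - h t) * (v s * w t - w s * v t)
        = (v s * h s * w t - w s * h s * v t) - (v s * (w t * h t) - w s * (v t * h t)) :=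
      fun t => by ring
    simp only [e]
    rw [intervalIntegral.integral_sub (i (by fun_prop)) (i (by fun_prop)),
      intervalIntegral.integral_sub (i (by fun_prop)) (i (by fun_prop)),
      intervalIntegral.integral_sub (i (by fun_prop)) (i (by fun_prop))]
    simp only [intervalIntegral.integral_const_mul]
    rfl
  have outer : ∫ s in a..b, ((v s * h s * W - w s * h s * V) - (v s * Wh - w s * Vh))
      = 2 * (Vh * W - Wh * V) := by
    rw [intervalIntegral.integral_sub (i (by fun_prop)) (i (by fun_prop)),
      intervalIntegral.integral_sub (i (by fun_prop)) (i (by fun_prop)),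
      intervalIntegral.integral_sub (i (by fun_prop)) (i (by fun_prop))]
    simp only [intervalIntegral.integral_mul_const]
    change Vh * W - Wh * V - (V * Wh - W * Vh) = _
    ring
  have nn : 0 ≤ ∫ s in a..b, ((v s * h s * W - w s * h s * V) - (v s * Wh - w s * Vh)) :=
    intervalIntegral.integral_nonneg hab fun s hs => by
      rw [← inner s]
      exact intervalIntegral.integral_nonneg hab fun t ht => H s hs t ht
  linarith

/-! ### Elementary trigonometric inequalities -/

theorem mul_sin_le_sin_mul {b x : ℝ} (hb0 : 0 ≤ b) (hb1 : b ≤ 1) (hx0 : 0 ≤ x) (hx1 : x ≤ π) :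
    b * Real.sin x ≤ Real.sin (b * x) := by
  have h := strictConcaveOn_sin_Icc.concaveOn.2 (show (0 : ℝ) ∈ Icc 0 π from ⟨le_rfl, Real.pi_pos.le⟩)
    (show x ∈ Icc 0 π from ⟨hx0, hx1⟩) (show 0 ≤ 1 - b by linarith) hb0 (by ring)
  simpa using h

theorem cos_mul_pos {b x : ℝ} (hb0 : 0 ≤ b) (hb1 : b ≤ 1) (hx0 : 0 ≤ x) (hx1 : x < π / 2) :
    0 < Real.cos (b * x) :=
  Real.cos_pos_of_mem_Ioo ⟨by nlinarith [Real.pi_pos], by nlinarith⟩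

theorem sin_mul_nonneg {b x : ℝ} (hb0 : 0 ≤ b) (hb1 : b ≤ 1) (hx0 : 0 ≤ x) (hx1 : x < π / 2) :
    0 ≤ Real.sin (b * x) :=
  Real.sin_nonneg_of_nonneg_of_le_pi (by positivity) (by nlinarith)

/-- The difference of the sides vanishes at `0` and has derivative `b (sec² y - sec² (b y)) ≥ 0`. -/
theorem tan_mul_le {b x : ℝ} (hb0 : 0 ≤ b) (hb1 : b ≤ 1) (hx0 : 0 ≤ x) (hx1 : x < π / 2) :
    Real.tan (b * x) ≤ b * Real.tan x := by
  have hd : ∀ y ∈ Ico 0 (π / 2), HasDerivAt (fun y => b * Real.tan y - Real.tan (b * y))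
      (b * (1 / Real.cos y ^ 2) - 1 / Real.cos (b * y) ^ 2 * b) y := by
    intro y hy
    have c1 : Real.cos y ≠ 0 := (Real.cos_pos_of_mem_Ioo ⟨by linarith [hy.1, Real.pi_pos], hy.2⟩).ne'
    have c2 := (cos_mul_pos hb0 hb1 hy.1 hy.2).ne'
    have d : HasDerivAt (fun y => b * y) b y := by
      simpa using (hasDerivAt_id y).const_mul b
    exact ((Real.hasDerivAt_tan c1).const_mul b).sub ((Real.hasDerivAt_tan c2).comp y d)
  have hm : MonotoneOn (fun y => b * Real.tan y - Real.tan (b * y)) (Ico 0 (π / 2)) := by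
    refine monotoneOn_of_deriv_nonneg (convex_Ico _ _)
      (fun y hy => (hd y hy).continuousAt.continuousWithinAt)
      (fun y hy => (hd y (interior_subset hy)).differentiableAt.differentiableWithinAt)
      fun y hy => ?_
    have hy' := interior_subset hy
    rw [(hd y hy').deriv]
    have c1 : 0 < Real.cos y := Real.cos_pos_of_mem_Ioo ⟨by linarith [hy'.1, Real.pi_pos], hy'.2⟩
    have c3 : Real.cos y ≤ Real.cos (b * y) :=
      Real.cos_le_cos_of_nonneg_of_le_pi (mul_nonneg hb0 hy'.1) (by linarith [hy'.2, Real.pi_pos])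
        (mul_le_of_le_one_left hy'.1 hb1)
    have : 1 / Real.cos (b * y) ^ 2 ≤ 1 / Real.cos y ^ 2 := by gcongr
    nlinarith
  have := hm ⟨le_rfl, by positivity⟩ ⟨hx0, hx1⟩ hx0
  simp at this
  linarith

/-- The quotient `tan (b y) / tan y` is antitone: its derivative has the sign of `b sin 2y - sin
2by`, which is nonpositive because sine is concave on `[0, π]`. -/
theorem tan_mul_mul_tan_le {b x y : ℝ} (hb0 : 0 ≤ b) (hb1 : b ≤ 1) (hx0 : 0 ≤ x) (hxy : x ≤ y)
    (hy1 : y < π / 2) :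
    Real.tan (b * y) * Real.tan x ≤ Real.tan (b * x) * Real.tan y := by
  rcases hx0.eq_or_lt with rfl | hx
  · simp
  have cpos : ∀ y ∈ Ioo 0 (π / 2), 0 < Real.cos y := fun y hy =>
    Real.cos_pos_of_mem_Ioo ⟨by linarith [hy.1, Real.pi_pos], hy.2⟩
  have tpos : ∀ y ∈ Ioo 0 (π / 2), 0 < Real.tan y := fun y hy =>
    Real.tan_pos_of_pos_of_lt_pi_div_two hy.1 hy.2
  have hd : ∀ y ∈ Ioo 0 (π / 2), HasDerivAt (fun y => Real.tan (b * y) / Real.tan y)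
      ((1 / Real.cos (b * y) ^ 2 * b * Real.tan y - Real.tan (b * y) * (1 / Real.cos y ^ 2))
        / Real.tan y ^ 2) y := by
    intro y hy
    have c2 := (cos_mul_pos hb0 hb1 hy.1.le hy.2).ne'
    have d : HasDerivAt (fun y => b * y) b y := by
      simpa using (hasDerivAt_id y).const_mul b
    exact ((Real.hasDerivAt_tan c2).comp y d).div (Real.hasDerivAt_tan (cpos y hy).ne')
      (tpos y hy).ne'
  have hm : AntitoneOn (fun y => Real.tan (b * y) / Real.tan y) (Ioo 0 (π / 2)) := by
    refine antitoneOn_of_deriv_nonpos (convex_Ioo _ _)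
      (fun y hy => (hd y hy).continuousAt.continuousWithinAt)
      (fun y hy => (hd y (interior_subset hy)).differentiableAt.differentiableWithinAt)
      fun y hy => ?_
    have hy' := interior_subset hy
    rw [(hd y hy').deriv]
    refine div_nonpos_of_nonpos_of_nonneg ?_ (sq_nonneg _)
    have c1 := cpos y hy'
    have c2 := cos_mul_pos hb0 hb1 hy'.1.le hy'.2
    have h := mul_sin_le_sin_mul hb0 hb1 (x := 2 * y) (by linarith [hy'.1]) (by linarith [hy'.2])
    rw [show b * (2 * y) = 2 * (b * y) by ring, Real.sin_two_mul, Real.sin_two_mul] at h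
    have e : 1 / Real.cos (b * y) ^ 2 * b * Real.tan y - Real.tan (b * y) * (1 / Real.cos y ^ 2)
        = (b * (2 * Real.sin y * Real.cos y) - 2 * Real.sin (b * y) * Real.cos (b * y))
          / (2 * Real.cos (b * y) ^ 2 * Real.cos y ^ 2) := by
      rw [Real.tan_eq_sin_div_cos, Real.tan_eq_sin_div_cos]; field_simp
    rw [e]
    exact div_nonpos_of_nonpos_of_nonneg (by linarith) (by positivity)
  have hx' : x ∈ Ioo 0 (π / 2) := ⟨hx, hxy.trans_lt hy1⟩
  have hy' : y ∈ Ioo 0 (π / 2) := ⟨hx.trans_le hxy, hy1⟩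
  have := hm hx' hy' hxy
  exact (div_le_div_iff₀ (tpos y hy') (tpos x hx')).1 this

/-- The logarithmic derivative of `cos (b arcsin (r y))` in `y` is `-b r tan (b arcsin (r y)) / √(1
- r² y²)`, which decreases as `r` grows. Hence the quotient for `q` over that for `p` is antitone.
It is used with `p = sin α`, `q = sin β` and `y = sin s`, to compare the weights `cos (bϕ)` at two
angles. -/
theorem cos_mul_arcsin_ratio {b p q x y : ℝ} (hb0 : 0 ≤ b) (hb1 : b ≤ 1) (hp : 0 ≤ p)
    (hpq : p ≤ q) (hq : q < 1) (hx : 0 ≤ x) (hxy : x ≤ y) (hy : y ≤ 1) :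
    Real.cos (b * Real.arcsin (p * x)) * Real.cos (b * Real.arcsin (q * y)) ≤
      Real.cos (b * Real.arcsin (q * x)) * Real.cos (b * Real.arcsin (p * y)) := by
  have range : ∀ r, 0 ≤ r → r < 1 → ∀ y ∈ Icc (0 : ℝ) 1,
      0 ≤ Real.arcsin (r * y) ∧ Real.arcsin (r * y) < π / 2 ∧ -1 < r * y ∧ r * y < 1 := by
    intro r h0 h1 y hy
    have : 0 ≤ r * y := mul_nonneg h0 hy.1
    have h : r * y < 1 := by nlinarith [hy.2]
    exact ⟨Real.arcsin_nonneg.2 this, Real.arcsin_lt_pi_div_two.2 h, by linarith, h⟩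
  have hd : ∀ r, 0 ≤ r → r < 1 → ∀ y ∈ Icc (0 : ℝ) 1,
      HasDerivAt (fun y => Real.cos (b * Real.arcsin (r * y)))
        (-Real.sin (b * Real.arcsin (r * y)) * (b * (1 / √(1 - (r * y) ^ 2) * r))) y := by
    intro r h0 h1 y hy
    obtain ⟨-, -, l, u⟩ := range r h0 h1 y hy
    have d : HasDerivAt (fun y => r * y) r y := by
      simpa using (hasDerivAt_id y).const_mul r
    exact (((Real.hasDerivAt_arcsin l.ne' u.ne).comp y d).const_mul b).cos
  have hp1 := hpq.trans_lt hq
  have hq0 := hp.trans hpq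
  have cp : ∀ r, 0 ≤ r → r < 1 → ∀ y ∈ Icc (0 : ℝ) 1, 0 < Real.cos (b * Real.arcsin (r * y)) :=
    fun r h0 h1 y hy => cos_mul_pos hb0 hb1 (range r h0 h1 y hy).1 (range r h0 h1 y hy).2.1
  have hD := fun y hy => (hd q hq0 hq y hy).div (hd p hp hp1 y hy) (cp p hp hp1 y hy).ne'
  have hm : AntitoneOn (fun y => Real.cos (b * Real.arcsin (q * y))
      / Real.cos (b * Real.arcsin (p * y))) (Icc 0 1) := by
    refine antitoneOn_of_deriv_nonpos (convex_Icc _ _)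
      (fun y hy => (hD y hy).continuousAt.continuousWithinAt)
      (fun y hy => (hD y (interior_subset hy)).differentiableAt.differentiableWithinAt)
      fun y hy => ?_
    have hy' := interior_subset hy
    refine (hD y hy').deriv.trans_le ?_
    refine div_nonpos_of_nonpos_of_nonneg ?_ (sq_nonneg _)
    obtain ⟨p0, p1, -, -⟩ := range p hp hp1 y hy'
    obtain ⟨q0, q1, ql, qu⟩ := range q hq0 hq y hy'
    have pq : Real.arcsin (p * y) ≤ Real.arcsin (q * y) :=
      Real.monotone_arcsin (mul_le_mul_of_nonneg_right hpq hy'.1)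
    have bpq := mul_le_mul_of_nonneg_left pq hb0
    have bq := mul_le_of_le_one_left q0 hb1
    have s1 : Real.sin (b * Real.arcsin (p * y)) ≤ Real.sin (b * Real.arcsin (q * y)) :=
      Real.sin_le_sin_of_le_of_le_pi_div_two
        (by linarith [mul_nonneg hb0 p0, Real.pi_pos]) (by linarith) bpq
    have c1 : Real.cos (b * Real.arcsin (q * y)) ≤ Real.cos (b * Real.arcsin (p * y)) :=
      Real.cos_le_cos_of_nonneg_of_le_pi (mul_nonneg hb0 p0) (by linarith [Real.pi_pos]) bpq
    have c2 := cp p hp hp1 y hy'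
    have c3 := cp q hq0 hq y hy'
    have s0 := sin_mul_nonneg hb0 hb1 p0 p1
    have w : 0 < 1 - (q * y) ^ 2 := by nlinarith
    have r1 : 1 / √(1 - (p * y) ^ 2) ≤ 1 / √(1 - (q * y) ^ 2) := by
      apply one_div_le_one_div_of_le (Real.sqrt_pos.2 w)
      apply Real.sqrt_le_sqrt
      have := mul_le_mul_of_nonneg_right hpq hy'.1
      have := mul_nonneg hp hy'.1
      nlinarith
    have r2 : b * (1 / √(1 - (p * y) ^ 2) * p) ≤ b * (1 / √(1 - (q * y) ^ 2) * q) := by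
      gcongr
    have r0 : 0 ≤ b * (1 / √(1 - (p * y) ^ 2) * p) := by positivity
    have := mul_le_mul (mul_le_mul s1 c1 c3.le (s0.trans s1)) r2 r0
      (mul_nonneg (s0.trans s1) c2.le)
    linarith
  have hx' : x ∈ Icc (0 : ℝ) 1 := ⟨hx, hxy.trans hy⟩
  have hy' : y ∈ Icc (0 : ℝ) 1 := ⟨hx.trans hxy, hy⟩
  have := (div_le_div_iff₀ (cp p hp hp1 y hy') (cp p hp hp1 x hx')).1 (hm hx' hy' hxy)
  linarith

theorem integral_tan_phase_sq {α : ℝ} (h0 : 0 < α) (h1 : α < π / 2) :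
    ∫ s in (0 : ℝ)..π, Real.tan (phase α s) ^ 2 = π / Real.cos α - π := by
  have hc : 0 < Real.cos α := Real.cos_pos_of_mem_Ioo ⟨by linarith, h1⟩
  have hac := Real.sin_sq_add_cos_sq α
  set c := Real.cos α
  have hD : ∀ s, 0 < Real.cos s ^ 2 + c * Real.sin s ^ 2 := by
    intro s
    rcases eq_or_ne (Real.sin s) 0 with h | h
    · have := Real.sin_sq_add_cos_sq s
      rw [h] at this ⊢
      nlinarith
    · positivity
  -- Since `cos² ϕ = cos² s + c² sin² s`, the natural primitive of `sec² ϕ` is `arctan (c tan s) /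
  -- c`, which breaks at `π/2`. Subtracting it from `s / c` and applying the arctangent subtraction
  -- formula gives this globally smooth version.
  have hd : ∀ s, HasDerivAt (fun s => 1 / c * (s - Real.arctan ((1 - c) * (Real.sin s * Real.cos s)
      / (Real.cos s ^ 2 + c * Real.sin s ^ 2))) - s) (Real.tan (phase α s) ^ 2) s := by
    intro s
    have dS := Real.hasDerivAt_sin s
    have dX := Real.hasDerivAt_cos s
    have d := ((((hasDerivAt_id s).sub ((((dS.mul dX).const_mul (1 - c)).div
      ((dX.pow 2).add ((dS.pow 2).const_mul c)) (hD s).ne').arctan)).const_mul (1 / c)).sub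
      (hasDerivAt_id s))
    refine d.congr_deriv ?_
    have hC := cos_phase_pos h0 h1 s
    have e := Real.sin_sq_add_cos_sq (phase α s)
    have e2 := Real.sin_sq_add_cos_sq s
    have hs := sin_phase α s
    have hK : Real.cos (phase α s) ^ 2 = Real.cos s ^ 2 + c ^ 2 * Real.sin s ^ 2 := by
      rw [hs] at e
      linear_combination e - e2 - Real.sin s ^ 2 * hac
    have hK0 : Real.cos s ^ 2 + c ^ 2 * Real.sin s ^ 2 ≠ 0 := hK ▸ (pow_pos hC 2).ne'
    rw [Real.tan_eq_sin_div_cos, div_pow, hK, hs]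
    have hDs := (hD s).ne'
    have hsum : 1 + ((1 - c) * (Real.sin s * Real.cos s)
        / (Real.cos s ^ 2 + c * Real.sin s ^ 2)) ^ 2
        = (Real.cos s ^ 2 + c ^ 2 * Real.sin s ^ 2) / (Real.cos s ^ 2 + c * Real.sin s ^ 2) ^ 2 := by
      field_simp
      linear_combination (Real.cos s ^ 2 + c ^ 2 * Real.sin s ^ 2) * e2
    have hM : (1 - c) * (Real.cos s * Real.cos s + Real.sin s * -Real.sin s)
          * (Real.cos s ^ 2 + c * Real.sin s ^ 2)
        - (1 - c) * (Real.sin s * Real.cos s) * (2 * Real.cos s * -Real.sin s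
          + c * (2 * Real.sin s * Real.cos s))
        = Real.cos s ^ 2 + c ^ 2 * Real.sin s ^ 2 - c := by
      linear_combination (Real.cos s ^ 2 + c ^ 2 * Real.sin s ^ 2
        - c * (Real.sin s ^ 2 + Real.cos s ^ 2 + 1)) * e2
    simp only [Pi.mul_apply, Pi.pow_apply, Pi.add_apply, Pi.div_apply, Nat.add_one_sub_one, pow_one,
      Nat.cast_ofNat]
    rw [hsum, hM]
    field_simp
    linear_combination -c * (e2 + Real.sin s ^ 2 * hac)
  have hcont : Continuous fun s => Real.tan (phase α s) ^ 2 := (continuous_tan_phase h0 h1).pow 2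
  rw [intervalIntegral.integral_eq_sub_of_hasDerivAt (fun s _ => hd s)
    (hcont.intervalIntegrable _ _)]
  simp
  ring

/-! ### Comparison of the integrals -/

theorem phase_mem {α s : ℝ} (h0 : 0 < α) (h1 : α < π / 2) (hs : s ∈ Icc 0 π) :
    0 ≤ phase α s ∧ phase α s < π / 2 :=
  ⟨Real.arcsin_nonneg.2 (mul_nonneg (Real.sin_nonneg_of_nonneg_of_le_pi h0.le (by linarith))
      (Real.sin_nonneg_of_mem_Icc hs)),
    Real.arcsin_lt_pi_div_two.2 (abs_lt.1 (abs_sin_mul_sin_lt_one h0 h1 s)).2⟩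

theorem phase_le_of_sin_le {α s t : ℝ} (h0 : 0 < α) (h1 : α < π / 2)
    (h : Real.sin s ≤ Real.sin t) : phase α s ≤ phase α t :=
  Real.monotone_arcsin (mul_le_mul_of_nonneg_left h
    (Real.sin_nonneg_of_nonneg_of_le_pi h0.le (by linarith)))

theorem continuous_mul_phase (b α : ℝ) : Continuous fun s => b * phase α s :=
  continuous_const.mul (continuous_phase_right α)

theorem continuous_cos_mul_phase (b α : ℝ) : Continuous fun s => Real.cos (b * phase α s) :=
  Real.continuous_cos.comp (continuous_mul_phase b α)

theorem continuous_sin_mul_tan {α : ℝ} (h0 : 0 < α) (h1 : α < π / 2) (b : ℝ) :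
    Continuous fun s => Real.sin (b * phase α s) * Real.tan (phase α s) :=
  (Real.continuous_sin.comp (continuous_mul_phase b α)).mul (continuous_tan_phase h0 h1)

theorem tan_le_tan_of_nonneg {x y : ℝ} (hx : 0 ≤ x) (hxy : x ≤ y) (hy : y < π / 2) :
    Real.tan x ≤ Real.tan y :=
  Real.strictMonoOn_tan.monotoneOn ⟨by linarith [Real.pi_pos], hxy.trans_lt hy⟩
    ⟨by linarith [Real.pi_pos], hy⟩ hxy

theorem cos_mul_phase_pos {b α : ℝ} (hb0 : 0 < b) (hb1 : b ≤ 1) (h0 : 0 < α) (h1 : α < π / 2)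
    {s : ℝ} (hs : s ∈ Icc 0 π) : 0 < Real.cos (b * phase α s) :=
  cos_mul_pos hb0.le hb1 (phase_mem h0 h1 hs).1 (phase_mem h0 h1 hs).2

theorem cosInt_pos {b α : ℝ} (hb0 : 0 < b) (hb1 : b ≤ 1) (h0 : 0 < α) (h1 : α < π / 2) :
    0 < cosInt b α :=
  intervalIntegral.intervalIntegral_pos_of_pos_on
    ((continuous_cos_mul_phase b α).intervalIntegrable _ _)
    (fun _ hs => cos_mul_phase_pos hb0 hb1 h0 h1 (Ioo_subset_Icc_self hs)) Real.pi_pos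

theorem sinTanInt_nonneg {b α : ℝ} (hb0 : 0 < b) (hb1 : b ≤ 1) (h0 : 0 < α) (h1 : α < π / 2) :
    0 ≤ sinTanInt b α :=
  intervalIntegral.integral_nonneg Real.pi_pos.le fun s hs => by
    obtain ⟨p0, p1⟩ := phase_mem h0 h1 hs
    exact mul_nonneg (sin_mul_nonneg hb0.le hb1 p0 p1)
      (Real.tan_nonneg_of_nonneg_of_le_pi_div_two p0 p1.le)

/-- From `tan (bϕ) ≤ tan ϕ` one gets `sin (bϕ) tan ϕ ≤ cos (bϕ) tan² ϕ`. As `cos (bϕ)` and `tan² ϕ`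
are oppositely monotone in `ϕ`, Chebyshev bounds the integral of their product by the product of
their means, and the mean of `tan² ϕ` is `1 / cos α - 1`. -/
theorem sinTanInt_mul_cos_le {b α : ℝ} (hb0 : 0 < b) (hb1 : b ≤ 1) (h0 : 0 < α) (h1 : α < π / 2) :
    sinTanInt b α * Real.cos α ≤ cosInt b α * (1 - Real.cos α) := by
  have hc : 0 < Real.cos α := Real.cos_pos_of_mem_Ioo ⟨by linarith, h1⟩
  have ct := continuous_tan_phase h0 h1
  have cc := continuous_cos_mul_phase b α
  have i1 : sinTanInt b α ≤ ∫ s in (0 : ℝ)..π,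
      Real.cos (b * phase α s) * Real.tan (phase α s) ^ 2 := by
    refine intervalIntegral.integral_mono_on Real.pi_pos.le
      ((continuous_sin_mul_tan h0 h1 b).intervalIntegrable _ _)
      ((cc.mul (ct.pow 2)).intervalIntegrable _ _) fun s hs => ?_
    obtain ⟨p0, p1⟩ := phase_mem h0 h1 hs
    have c := cos_mul_phase_pos hb0 hb1 h0 h1 hs
    have t := Real.tan_nonneg_of_nonneg_of_le_pi_div_two p0 p1.le
    have l : Real.tan (b * phase α s) ≤ Real.tan (phase α s) :=
      (tan_mul_le hb0.le hb1 p0 p1).trans (mul_le_of_le_one_left t hb1)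
    rw [← Real.tan_mul_cos c.ne', mul_comm (Real.tan (b * _)), mul_assoc, sq]
    gcongr
  have i2 := integral_mul_integral_le_of_weights Real.pi_pos.le (ct.pow 2)
    (continuous_const (y := (1 : ℝ))) cc fun s hs t ht => by
      rw [one_mul, mul_one]
      rcases le_total (Real.sin s) (Real.sin t) with h | h
      · have p := phase_le_of_sin_le h0 h1 h
        obtain ⟨p0, -⟩ := phase_mem h0 h1 hs
        obtain ⟨-, q1⟩ := phase_mem h0 h1 ht
        have tt := tan_le_tan_of_nonneg p0 p q1
        have t0 := Real.tan_nonneg_of_nonneg_of_le_pi_div_two p0 (p.trans q1.le)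
        refine mul_nonneg_of_nonpos_of_nonpos (sub_nonpos.2 (pow_le_pow_left₀ t0 tt 2))
          (sub_nonpos.2 (Real.cos_le_cos_of_nonneg_of_le_pi (by positivity) ?_ (by gcongr)))
        nlinarith
      · have p := phase_le_of_sin_le h0 h1 h
        obtain ⟨p0, -⟩ := phase_mem h0 h1 ht
        obtain ⟨-, q1⟩ := phase_mem h0 h1 hs
        have tt := tan_le_tan_of_nonneg p0 p q1
        have t0 := Real.tan_nonneg_of_nonneg_of_le_pi_div_two p0 (p.trans q1.le)
        refine mul_nonneg (sub_nonneg.2 (pow_le_pow_left₀ t0 tt 2))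
          (sub_nonneg.2 (Real.cos_le_cos_of_nonneg_of_le_pi (by positivity) ?_ (by gcongr)))
        nlinarith
  simp only [Pi.pow_apply, one_mul, integral_tan_phase_sq h0 h1, intervalIntegral.integral_const, sub_zero,
    smul_eq_mul, mul_one] at i2
  change _ ≤ _ * cosInt b α at i2
  have i3 := (mul_le_mul_of_nonneg_right i1 Real.pi_pos.le).trans i2
  have e : (π / Real.cos α - π) * cosInt b α
      = (cosInt b α * (1 - Real.cos α) / Real.cos α) * π := by
    field_simp
  rw [e] at i3
  exact (le_div_iff₀ hc).1 (le_of_mul_le_mul_right i3 Real.pi_pos)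

/-- After clearing denominators this is `cos β cos ϕ_α ≤ cos α cos ϕ_β`, and the difference of the
squares is `(sin² β - sin² α)(1 - sin² s)`. -/
theorem tan_mul_tan_phase_le {α β s : ℝ} (h0 : 0 < α) (hαβ : α ≤ β) (hβ : β < π / 2)
    (hs : 0 ≤ Real.sin s) :
    Real.tan α * Real.tan (phase β s) ≤ Real.tan β * Real.tan (phase α s) := by
  have h1 := hαβ.trans_lt hβ
  have hβ0 := h0.trans_le hαβ
  have sα : 0 < Real.sin α := Real.sin_pos_of_pos_of_lt_pi h0 (by linarith)
  have sβ : 0 < Real.sin β := Real.sin_pos_of_pos_of_lt_pi hβ0 (by linarith)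
  have cα : 0 < Real.cos α := Real.cos_pos_of_mem_Ioo ⟨by linarith, h1⟩
  have cβ : 0 < Real.cos β := Real.cos_pos_of_mem_Ioo ⟨by linarith, hβ⟩
  have sαβ : Real.sin α ≤ Real.sin β :=
    Real.sin_le_sin_of_le_of_le_pi_div_two (by linarith) hβ.le hαβ
  have kα := cos_phase_pos h0 h1 s
  have kβ := cos_phase_pos hβ0 hβ s
  have eα := Real.sin_sq_add_cos_sq (phase α s)
  have eβ := Real.sin_sq_add_cos_sq (phase β s)
  have fα := Real.sin_sq_add_cos_sq α
  have fβ := Real.sin_sq_add_cos_sq β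
  rw [sin_phase] at eα eβ
  have hs1 : Real.sin s ^ 2 ≤ 1 := Real.sin_sq_le_one s
  have sq : Real.cos β * Real.cos (phase α s) ≤ Real.cos α * Real.cos (phase β s) := by
    rw [← sq_le_sq₀ (by positivity) (by positivity), mul_pow, mul_pow,
      show Real.cos β ^ 2 = 1 - Real.sin β ^ 2 by linarith,
      show Real.cos α ^ 2 = 1 - Real.sin α ^ 2 by linarith,
      show Real.cos (phase α s) ^ 2 = 1 - (Real.sin α * Real.sin s) ^ 2 by linarith,
      show Real.cos (phase β s) ^ 2 = 1 - (Real.sin β * Real.sin s) ^ 2 by linarith]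
    linarith [mul_nonneg (sub_nonneg.2 (pow_le_pow_left₀ sα.le sαβ 2)) (sub_nonneg.2 hs1)]
  rw [Real.tan_eq_sin_div_cos, Real.tan_eq_sin_div_cos, Real.tan_eq_sin_div_cos,
    Real.tan_eq_sin_div_cos, sin_phase, sin_phase, div_mul_div_comm, div_mul_div_comm,
    div_le_div_iff₀ (by positivity) (by positivity)]
  have n : 0 ≤ Real.sin α * Real.sin β * Real.sin s := by positivity
  linarith [mul_le_mul_of_nonneg_left sq n]

theorem sq_mul_mul_le_of_ratios {A B P Q p q : ℝ} (hA : 0 ≤ A) (hP : 0 ≤ P)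
    (hQ : 0 ≤ Q) (hp : 0 ≤ p) (h : q * P ≤ p * Q) (h' : A * Q ≤ B * P) :
    A ^ 2 * (q * Q) ≤ B ^ 2 * (p * P) := by
  rcases hP.eq_or_lt with e | e
  · have : A * Q = 0 := le_antisymm (by simpa [← e] using h') (mul_nonneg hA hQ)
    rw [← e, show A ^ 2 * (q * Q) = A * q * (A * Q) by ring, this]
    simp
  · refine le_of_mul_le_mul_right ?_ e
    have y1 := mul_le_mul_of_nonneg_left h (mul_nonneg (sq_nonneg A) hQ)
    have y2 := mul_le_mul_of_nonneg_right (pow_le_pow_left₀ (mul_nonneg hA hQ) h' 2) hp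
    linarith

/-- Two steps lead from `β` to `α`. Pointwise, `tan (bϕ) tan ϕ` at `β` is at most `tan² β / tan² α`
times its value at `α`. Chebyshev then replaces the weight `cos (bϕ)` at `β` by the one at `α`:
relative to the latter, the former favours small `sin s`, where `tan (bϕ) tan ϕ` is small. -/
theorem sinTanInt_mul_cosInt_le {b α : ℝ} (hb0 : 0 < b) (hb1 : b ≤ 1) (h0 : 0 < α) (h1 : α < π / 2)
    {β : ℝ} (hαβ : α ≤ β) (hβ : β < π / 2) :
    Real.tan α ^ 2 * (sinTanInt b β * cosInt b α)
      ≤ Real.tan β ^ 2 * (sinTanInt b α * cosInt b β) := by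
  have hβ0 := h0.trans_le hαβ
  have sα : 0 < Real.sin α := Real.sin_pos_of_pos_of_lt_pi h0 (by linarith)
  have sβ : 0 < Real.sin β := Real.sin_pos_of_pos_of_lt_pi hβ0 (by linarith)
  have cα : 0 < Real.cos α := Real.cos_pos_of_mem_Ioo ⟨by linarith, h1⟩
  have cβ : 0 < Real.cos β := Real.cos_pos_of_mem_Ioo ⟨by linarith, hβ⟩
  have sαβ : Real.sin α ≤ Real.sin β :=
    Real.sin_le_sin_of_le_of_le_pi_div_two (by linarith) hβ.le hαβ
  have sβ1 : Real.sin β < 1 := by nlinarith [Real.sin_sq_add_cos_sq β]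
  have c1 := continuous_cos_mul_phase b α
  have c2 := continuous_cos_mul_phase b β
  -- a globally continuous version of `tan (b ϕ) tan ϕ`
  have hcpos : ∀ s, Real.cos (b * phase α s) ≠ 0 := by
    intro s
    have := abs_lt.1 (abs_sin_mul_sin_lt_one h0 h1 s)
    have u : phase α s < π / 2 := Real.arcsin_lt_pi_div_two.2 this.2
    have l : -(π / 2) < phase α s := Real.neg_pi_div_two_lt_arcsin.2 this.1
    refine (Real.cos_pos_of_mem_Ioo ⟨?_, ?_⟩).ne' <;> nlinarith [Real.pi_pos]
  have ch : Continuous fun s => Real.tan (b * phase α s) * Real.tan (phase α s) := by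
    refine Continuous.mul ?_ (continuous_tan_phase h0 h1)
    simp only [Real.tan_eq_sin_div_cos]
    exact (Real.continuous_sin.comp (continuous_mul_phase b α)).div c1 hcpos
  have key : ∀ s t, s ∈ Icc 0 π → t ∈ Icc 0 π → Real.sin s ≤ Real.sin t →
      Real.tan (b * phase α s) * Real.tan (phase α s)
        ≤ Real.tan (b * phase α t) * Real.tan (phase α t) ∧
      Real.cos (b * phase α s) * Real.cos (b * phase β t)
        ≤ Real.cos (b * phase β s) * Real.cos (b * phase α t) := by
    intro s t hs ht h
    obtain ⟨p0, p1⟩ := phase_mem h0 h1 hs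
    obtain ⟨q0, q1⟩ := phase_mem h0 h1 ht
    have p := phase_le_of_sin_le h0 h1 h
    refine ⟨?_, cos_mul_arcsin_ratio hb0.le hb1 sα.le sαβ sβ1 (Real.sin_nonneg_of_mem_Icc hs) h
      (Real.sin_le_one t)⟩
    have tt := tan_le_tan_of_nonneg p0 p q1
    have t0 := Real.tan_nonneg_of_nonneg_of_le_pi_div_two p0 p1.le
    have bt := tan_le_tan_of_nonneg (x := b * phase α s) (y := b * phase α t) (by positivity)
      (by gcongr) (by nlinarith)
    have bt0 := Real.tan_nonneg_of_nonneg_of_le_pi_div_two (x := b * phase α s) (by positivity)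
      (by nlinarith)
    exact mul_le_mul bt tt t0 (bt0.trans bt)
  have cheb := integral_mul_integral_le_of_weights Real.pi_pos.le ch c1 c2
    fun s hs t ht => by
      rcases le_total (Real.sin s) (Real.sin t) with h | h
      · obtain ⟨k1, k2⟩ := key s t hs ht h
        exact mul_nonneg_of_nonpos_of_nonpos (by linarith) (by linarith)
      · obtain ⟨k1, k2⟩ := key t s ht hs h
        exact mul_nonneg (by linarith) (by linarith)
  have e1 : ∫ s in (0 : ℝ)..π, Real.cos (b * phase α s)
      * (Real.tan (b * phase α s) * Real.tan (phase α s)) = sinTanInt b α := by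
    unfold sinTanInt
    congr 1
    funext s
    rw [← mul_assoc, mul_comm (Real.cos _), Real.tan_mul_cos (hcpos s)]
  have tα := Real.tan_pos_of_pos_of_lt_pi_div_two h0 h1
  have tβ := Real.tan_pos_of_pos_of_lt_pi_div_two hβ0 hβ
  have i1 : Real.tan α ^ 2 * sinTanInt b β ≤ Real.tan β ^ 2 * ∫ s in (0 : ℝ)..π,
      Real.cos (b * phase β s) * (Real.tan (b * phase α s) * Real.tan (phase α s)) := by
    unfold sinTanInt
    rw [← intervalIntegral.integral_const_mul, ← intervalIntegral.integral_const_mul]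
    refine intervalIntegral.integral_mono_on Real.pi_pos.le
      (((continuous_sin_mul_tan hβ0 hβ b).const_mul _).intervalIntegrable _ _)
      (((c2.mul ch).const_mul _).intervalIntegrable _ _) fun s hs => ?_
    obtain ⟨p0, p1⟩ := phase_mem h0 h1 hs
    obtain ⟨q0, q1⟩ := phase_mem hβ0 hβ hs
    have ss := Real.sin_nonneg_of_mem_Icc hs
    have pq : phase α s ≤ phase β s :=
      Real.monotone_arcsin (mul_le_mul_of_nonneg_right sαβ ss)
    have cc := cos_mul_phase_pos hb0 hb1 hβ0 hβ hs
    have r := tan_mul_mul_tan_le hb0.le hb1 p0 pq q1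
    have tp := Real.tan_nonneg_of_nonneg_of_le_pi_div_two p0 p1.le
    have tq := Real.tan_nonneg_of_nonneg_of_le_pi_div_two q0 q1.le
    have tbp := Real.tan_nonneg_of_nonneg_of_le_pi_div_two (x := b * phase α s) (by positivity)
      (by nlinarith)
    have tt := tan_mul_tan_phase_le h0 hαβ hβ ss
    -- One factor `tan β / tan α` bounds the growth of `tan ϕ`; the second is available because `tan
    -- (bϕ)` grows by no larger a ratio than `tan ϕ`.
    have x1 := sq_mul_mul_le_of_ratios tα.le tp tq tbp r tt
    rw [← Real.tan_mul_cos cc.ne']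
    linarith [mul_le_mul_of_nonneg_left x1 cc.le]
  rw [e1] at cheb
  have := mul_le_mul_of_nonneg_right i1 (cosInt_pos hb0 hb1 h0 h1).le
  have := mul_le_mul_of_nonneg_left cheb (sq_nonneg (Real.tan β))
  change _ * (_ * cosInt b α) ≤ _ * (_ * cosInt b β) at this
  linarith

theorem continuous_cosInt (b : ℝ) : Continuous (cosInt b) := by
  unfold cosInt
  have h := continuous_phase
  refine intervalIntegral.continuous_parametric_intervalIntegral_of_continuous' ?_ _ _
  exact Real.continuous_cos.comp (continuous_const.mul h)

/-- The tangent is only controlled for angles in `(0, π/2)`. A general parameter space allows the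
subtype of that interval, on which the integrand is jointly continuous everywhere. -/
theorem continuous_sinTanInt_comp {X : Type*} [TopologicalSpace X] [FirstCountableTopology X]
    (b : ℝ) {g : X → ℝ} (hg : Continuous g) (h0 : ∀ x, 0 < g x) (h1 : ∀ x, g x < π / 2) :
    Continuous fun x => sinTanInt b (g x) := by
  have h : Continuous fun q : X × ℝ => phase (g q.1) q.2 := by
    unfold phase; fun_prop
  have hb : Continuous fun q : X × ℝ => b * phase (g q.1) q.2 := continuous_const.mul h
  have hs : Continuous fun q : X × ℝ => Real.sin (b * phase (g q.1) q.2) :=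
    Real.continuous_sin.comp hb
  have ht : Continuous fun q : X × ℝ => Real.tan (phase (g q.1) q.2) := by
    simp only [Real.tan_eq_sin_div_cos]
    exact (Real.continuous_sin.comp h).div (Real.continuous_cos.comp h)
      fun q => (cos_phase_pos (h0 q.1) (h1 q.1) q.2).ne'
  have c : Continuous fun q : X × ℝ =>
      Real.sin (b * phase (g q.1) q.2) * Real.tan (phase (g q.1) q.2) := hs.mul ht
  exact intervalIntegral.continuous_parametric_intervalIntegral_of_continuous'
    (f := fun x s => Real.sin (b * phase (g x) s) * Real.tan (phase (g x) s)) c 0 π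

theorem continuousOn_sinTanInt (b : ℝ) : ContinuousOn (sinTanInt b) (Ioo 0 (π / 2)) := by
  rw [continuousOn_iff_continuous_domRestrict]
  exact continuous_sinTanInt_comp b continuous_subtype_val (fun x => x.2.1) fun x => x.2.2

/-! ### The quadratic equation for the parameter `m` -/

/-- The constant coefficient of the quadratic equation, in terms of `a = sin α`, `c = cos α`, and
the values `E, F` and `E', F'` of `cosInt`, `sinTanInt` at `α` and `π / 2 - α`. -/
def quadA (a c E F E' F' : ℝ) : ℝ := 2 * (a ^ 4 * E * F' - c ^ 4 * F * E')

/-- The linear coefficient of the quadratic equation. -/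
def quadB (a c E F E' F' : ℝ) : ℝ :=
  2 * a * c * (E * E' - 2 * a ^ 2 * E * F' - 2 * c ^ 2 * F * E' + F * F')

/-- The nonnegative root of `A m ^ 2 + B m - A`, for `0 ≤ A` and `0 < B`. -/
def quadRoot (A B : ℝ) : ℝ := 2 * A / (B + √(B ^ 2 + 4 * A ^ 2))

theorem quadRoot_spec {A B : ℝ} (hA : 0 ≤ A) (hB : 0 < B) :
    0 ≤ quadRoot A B ∧ A * quadRoot A B ^ 2 + B * quadRoot A B - A = 0 := by
  have hS := Real.sqrt_nonneg (B ^ 2 + 4 * A ^ 2)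
  have hS2 := Real.sq_sqrt (show 0 ≤ B ^ 2 + 4 * A ^ 2 by positivity)
  unfold quadRoot
  set S := √(B ^ 2 + 4 * A ^ 2)
  have hBS : 0 < B + S := by linarith
  refine ⟨by positivity, ?_⟩
  field_simp
  linear_combination -A * hS2

theorem lt_of_quadratic_lt {A B x y : ℝ} (hA : 0 ≤ A) (hB : 0 < B) (hy : 0 ≤ y)
    (h : A * x ^ 2 + B * x - A < A * y ^ 2 + B * y - A) : x < y := by
  by_contra! hxy
  have := mul_le_mul_of_nonneg_left (pow_le_pow_left₀ hy hxy 2) hA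
  have := mul_le_mul_of_nonneg_left hxy hB.le
  linarith

theorem quadratic_root_unique {A B x y : ℝ} (hA : 0 ≤ A) (hB : 0 < B) (hx : 0 ≤ x) (hy : 0 ≤ y)
    (ex : A * x ^ 2 + B * x - A = 0) (ey : A * y ^ 2 + B * y - A = 0) : x = y := by
  have h : (A * (x + y) + B) * (x - y) = 0 := by linear_combination ex - ey
  have : A * (x + y) + B ≠ 0 := by positivity
  exact sub_eq_zero.1 ((mul_eq_zero.1 h).resolve_left this)

theorem quadA_nonneg {a c E F E' F' : ℝ} (h : c ^ 4 * F * E' ≤ a ^ 4 * E * F') :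
    0 ≤ quadA a c E F E' F' := by
  unfold quadA; linarith

theorem quadB_pos {a c E F E' F' : ℝ} (ha : 0 < a) (hc : 0 < c) (hac : a ^ 2 + c ^ 2 = 1)
    (hE : 0 < E) (hF : 0 ≤ F) (hE' : 0 < E') (hF' : 0 ≤ F')
    (h : F * c ≤ E * (1 - c)) (h' : F' * a ≤ E' * (1 - a)) :
    0 < quadB a c E F E' F' := by
  refine mul_pos (by positivity) ?_
  -- The two bounds leave at least `E E' (1 - 2a(1-a) - 2c(1-c)) = E E' (3 - 2(a + c))`, and `a + c
  -- ≤ √2 < 3/2`.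
  have k1 := mul_le_mul_of_nonneg_left h' (show 0 ≤ 2 * a * E by positivity)
  have k2 := mul_le_mul_of_nonneg_left h (show 0 ≤ 2 * c * E' by positivity)
  have s : a + c < 3 / 2 := by nlinarith [sq_nonneg (a - c)]
  have k3 : 0 < E * E' * (3 - 2 * (a + c)) := mul_pos (mul_pos hE hE') (by linarith)
  have k4 := mul_nonneg hF hF'
  have k5 : 2 * (a ^ 2 + c ^ 2) * (E * E') = 2 * (E * E') := by rw [hac]; ring
  linarith

theorem quadratic_pos {a c E F E' F' : ℝ} (ha : 0 < a) (ha1 : a < 1)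
    (hac : a ^ 2 + c ^ 2 = 1) (hE : 0 < E) (hF : 0 ≤ F) (hE' : 0 < E') (hF' : 0 ≤ F')
    (h' : F' * a ≤ E' * (1 - a)) :
    0 < quadA a c E F E' F' * (a * c / (1 + a ^ 2)) ^ 2
      + quadB a c E F E' F' * (a * c / (1 + a ^ 2)) - quadA a c E F E' F' := by
  have hc2 : c ^ 2 = 1 - a ^ 2 := by linarith
  -- Eliminating `c²` where convenient, the negative `E F'` contribution is absorbed into the slack
  -- `E' (1 - a) - F' a`, so that every summand is visibly nonnegative and the `(1 - a)³` term is
  -- positive.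
  have e : quadA a c E F E' F' * (a * c / (1 + a ^ 2)) ^ 2
      + quadB a c E F E' F' * (a * c / (1 + a ^ 2)) - quadA a c E F E' F'
      = 2 * ((c ^ 2) ^ 3 * F * E' + a ^ 2 * c ^ 2 * (1 + a ^ 2) * F * F'
        + E * a ^ 2 * (1 - a) ^ 3 * E'
        + E * a ^ 2 * (E' * (1 - a) - F' * a) * a * (3 + a ^ 2)) / (1 + a ^ 2) ^ 2 := by
    have e' : quadA a c E F E' F' * (a * c / (1 + a ^ 2)) ^ 2
        + quadB a c E F E' F' * (a * c / (1 + a ^ 2)) - quadA a c E F E' F'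
        = 2 * (a ^ 4 * E * F' - (c ^ 2) ^ 2 * F * E') * (a ^ 2 * c ^ 2 / (1 + a ^ 2) ^ 2 - 1)
          + 2 * a ^ 2 * c ^ 2 * (E * E' - 2 * a ^ 2 * E * F' - 2 * c ^ 2 * F * E' + F * F')
            / (1 + a ^ 2) := by
      unfold quadA quadB
      field_simp
      ring
    rw [e', hc2]
    field_simp
    ring
  rw [e]
  have h1 : 0 < 1 - a := by linarith
  have h2 : 0 ≤ E' * (1 - a) - F' * a := by linarith
  positivity

theorem tilde_denominator_pos {a c E' F' m : ℝ} (ha : 0 < a) (hc : 0 < c)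
    (hac : a ^ 2 + c ^ 2 = 1) (hE' : 0 < E') (hF' : 0 ≤ F') (hm0 : 0 ≤ m)
    (hm : m < a * c / (1 + a ^ 2)) :
    0 < (1 - m ^ 2) * (c ^ 2 * E' + a ^ 2 * F') - 2 * m * a * c * (E' - F') := by
  rw [lt_div_iff₀ (by positivity)] at hm
  have ha1 : a < 1 := by nlinarith
  have hc1 : c < 1 := by nlinarith
  have hma : m < a * c := by nlinarith [mul_nonneg hm0 (sq_nonneg a)]
  have hm1 : m < 1 := hma.trans (by nlinarith)
  have hm2 : 0 ≤ 1 - m ^ 2 := by nlinarith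
  -- Times `1 + a²`, and with `m (1 + a²)` and `m² (1 + a²)` replaced by their upper bounds `a c`
  -- and `(a c)²`, the expression becomes exactly `c⁵`. This is the factor of `E'`; the coefficient
  -- of `F'` is nonnegative anyway.
  have key : 0 < c * (1 - m ^ 2) - 2 * m * a := by
    have k1 : m * (m * (1 + a ^ 2)) ≤ (a * c) * (a * c) :=
      mul_le_mul hma.le hm.le (by positivity) (by positivity)
    have k2 := mul_le_mul_of_nonneg_left k1 hc.le
    have k3 := mul_le_mul_of_nonneg_left hm.le ha.le
    have k4 : c * (1 + a ^ 2) - 2 * a ^ 2 * c - a ^ 2 * c ^ 3 = c ^ 5 := by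
      rw [show a ^ 2 = 1 - c ^ 2 by linarith]; ring
    have k5 : 0 < c ^ 5 := by positivity
    refine pos_of_mul_pos_left (b := 1 + a ^ 2) ?_ (by positivity)
    linarith
  have e : (1 - m ^ 2) * (c ^ 2 * E' + a ^ 2 * F') - 2 * m * a * c * (E' - F')
      = c * (c * (1 - m ^ 2) - 2 * m * a) * E' + ((1 - m ^ 2) * a ^ 2 + 2 * m * a * c) * F' := by
    ring
  rw [e]
  have : 0 < c * (c * (1 - m ^ 2) - 2 * m * a) * E' := mul_pos (mul_pos hc key) hE'
  positivity

theorem compatible_iff {k : ℕ} (hk : 2 ≤ k) {α : ℝ} (h0 : π / 4 ≤ α) (h1 : α < π / 2) (m : ℝ) :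
    Compatible k m α ↔
      (1 - m ^ 2) * (Real.cos α ^ 2 * cosInt (2 / k) (π / 2 - α)
        + Real.sin α ^ 2 * sinTanInt (2 / k) (π / 2 - α))
        - 2 * m * Real.sin α * Real.cos α
          * (cosInt (2 / k) (π / 2 - α) - sinTanInt (2 / k) (π / 2 - α)) ≠ 0 ∧
      quadA (Real.sin α) (Real.cos α) (cosInt (2 / k) α) (sinTanInt (2 / k) α)
          (cosInt (2 / k) (π / 2 - α)) (sinTanInt (2 / k) (π / 2 - α)) * m ^ 2
        + quadB (Real.sin α) (Real.cos α) (cosInt (2 / k) α) (sinTanInt (2 / k) α)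
          (cosInt (2 / k) (π / 2 - α)) (sinTanInt (2 / k) (π / 2 - α)) * m
        - quadA (Real.sin α) (Real.cos α) (cosInt (2 / k) α) (sinTanInt (2 / k) α)
          (cosInt (2 / k) (π / 2 - α)) (sinTanInt (2 / k) (π / 2 - α)) = 0 := by
  have hk0 : k ≠ 0 := by omega
  have hkR : (2 : ℝ) ≤ k := by exact_mod_cast hk
  have hb0 : (0 : ℝ) < 2 / k := by positivity
  have hb1 : (2 : ℝ) / k ≤ 1 := (div_le_one (by positivity)).2 hkR
  have hα0 : 0 < α := by linarith [Real.pi_pos]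
  have hβ0 : 0 < π / 2 - α := by linarith
  have hβ1 : π / 2 - α < π / 2 := by linarith
  have h' := sinTanInt_mul_cos_le hb0 hb1 hβ0 hβ1
  have E'pos := cosInt_pos hb0 hb1 hβ0 hβ1
  have hs2 : Real.sin (2 * (π / 2 - α)) = Real.sin (2 * α) := by
    rw [show 2 * (π / 2 - α) = π - 2 * α by ring, Real.sin_pi_sub]
  have p3 : 0 < Real.sin (2 * α) := Real.sin_pos_of_pos_of_lt_pi (by linarith) (by linarith)
  have hc : 0 < Real.cos α := Real.cos_pos_of_mem_Ioo ⟨by linarith, h1⟩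
  have ha : 0 < Real.sin α := Real.sin_pos_of_pos_of_lt_pi hα0 (by linarith)
  have hac := Real.sin_sq_add_cos_sq α
  unfold Compatible
  rw [Q₂tilde_eq_Q₁, C₂tilde_eq_C₁, Q₁_eq hk0 hα0 h1, Q₁_eq hk0 hβ0 hβ1, C₁_eq hk0 hα0 h1,
    C₁_eq hk0 hβ0 hβ1, hs2]
  rw [Real.cos_pi_div_two_sub] at h'
  rw [Real.sin_pi_div_two_sub, Real.cos_pi_div_two_sub]
  unfold quadA quadB
  generalize cosInt (2 / k) α = E at *
  generalize sinTanInt (2 / k) α = F at *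
  generalize cosInt (2 / k) (π / 2 - α) = E' at *
  generalize sinTanInt (2 / k) (π / 2 - α) = F' at *
  generalize Real.sin α = a at *
  generalize Real.cos α = c at *
  set τ := 2 / Real.sin (2 * α) with hτ
  have hτ0 : τ ≠ 0 := by positivity
  -- This is `C₂` up to a positive factor; the bound on `F' a` shows that it is at least `E' (1 -
  -- a)`.
  have hD : 0 < c ^ 2 * E' - a ^ 2 * F' := by
    have ha1 : 0 < 1 - a := by nlinarith
    have : c ^ 2 = (1 - a) * (1 + a) := by linarith
    have := mul_le_mul_of_nonneg_left h' ha.le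
    nlinarith [mul_pos ha1 E'pos]
  have eP : (1 - (-m) ^ 2) * (c ^ 2 * E' + a ^ 2 * F') + 2 * -m * c * a * (E' - F')
      = (1 - m ^ 2) * (c ^ 2 * E' + a ^ 2 * F') - 2 * m * a * c * (E' - F') := by ring
  rw [eP, mul_ne_zero_iff, mul_ne_zero_iff, mul_div_mul_left _ _ hτ0, mul_div_mul_left _ _ hτ0]
  constructor
  · rintro ⟨⟨-, hP⟩, -, e⟩
    refine ⟨hP, ?_⟩
    rw [div_eq_div_iff hP hD.ne'] at e
    -- The terms `E E'` and `F F'` come out of the cross product with the factor `a² + c²`, which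
    -- the multiple of `hac` normalizes to `1`.
    linear_combination e - 2 * m * a * c * (E * E' + F * F') * hac
  · rintro ⟨hP, e⟩
    refine ⟨⟨hτ0, hP⟩, ⟨hτ0, hD.ne'⟩, ?_⟩
    rw [div_eq_div_iff hP hD.ne']
    linear_combination e + 2 * m * a * c * (E * E' + F * F') * hac

/-! ### The solution of the period problem -/

/-- `quadA` evaluated at the integrals belonging to `α`. -/
def solutionA (b α : ℝ) : ℝ :=
  quadA (Real.sin α) (Real.cos α) (cosInt b α) (sinTanInt b α)
    (cosInt b (π / 2 - α)) (sinTanInt b (π / 2 - α))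

/-- `quadB` evaluated at the integrals belonging to `α`. -/
def solutionB (b α : ℝ) : ℝ :=
  quadB (Real.sin α) (Real.cos α) (cosInt b α) (sinTanInt b α)
    (cosInt b (π / 2 - α)) (sinTanInt b (π / 2 - α))

theorem solutionA_nonneg {b α : ℝ} (hb0 : 0 < b) (hb1 : b ≤ 1) (h0 : π / 4 ≤ α)
    (h1 : α < π / 2) : 0 ≤ solutionA b α := by
  have hα0 : 0 < α := by linarith [Real.pi_pos]
  have h := sinTanInt_mul_cosInt_le hb0 hb1 (α := π / 2 - α) (β := α) (by linarith) (by linarith)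
    (by linarith) h1
  have hc : 0 < Real.cos α := Real.cos_pos_of_mem_Ioo ⟨by linarith, h1⟩
  have ha : 0 < Real.sin α := Real.sin_pos_of_pos_of_lt_pi hα0 (by linarith)
  rw [Real.tan_eq_sin_div_cos, Real.tan_eq_sin_div_cos, Real.sin_pi_div_two_sub,
    Real.cos_pi_div_two_sub, div_pow, div_pow, div_mul_eq_mul_div, div_mul_eq_mul_div,
    div_le_div_iff₀ (by positivity) (by positivity)] at h
  exact quadA_nonneg (by linarith)

theorem solutionB_pos {b α : ℝ} (hb0 : 0 < b) (hb1 : b ≤ 1) (h0 : 0 < α)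
    (h1 : α < π / 2) : 0 < solutionB b α := by
  have hβ0 : 0 < π / 2 - α := by linarith
  have hβ1 : π / 2 - α < π / 2 := by linarith
  have h' := sinTanInt_mul_cos_le hb0 hb1 hβ0 hβ1
  rw [Real.cos_pi_div_two_sub] at h'
  exact quadB_pos (Real.sin_pos_of_pos_of_lt_pi h0 (by linarith))
    (Real.cos_pos_of_mem_Ioo ⟨by linarith, h1⟩) (Real.sin_sq_add_cos_sq α)
    (cosInt_pos hb0 hb1 h0 h1) (sinTanInt_nonneg hb0 hb1 h0 h1)
    (cosInt_pos hb0 hb1 hβ0 hβ1) (sinTanInt_nonneg hb0 hb1 hβ0 hβ1)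
    (sinTanInt_mul_cos_le hb0 hb1 h0 h1) h'

theorem continuousOn_quadRoot_solution {b : ℝ} (hb0 : 0 < b) (hb1 : b ≤ 1) :
    ContinuousOn (fun α => quadRoot (solutionA b α) (solutionB b α)) (Ioo 0 (π / 2)) := by
  have cE := (continuous_cosInt b).continuousOn (s := Ioo 0 (π / 2))
  have cF := continuousOn_sinTanInt b
  have cr : ContinuousOn (fun α => π / 2 - α) (Ioo 0 (π / 2)) := by fun_prop
  have mr : MapsTo (fun α => π / 2 - α) (Ioo 0 (π / 2)) (Ioo 0 (π / 2)) :=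
    fun α hα => ⟨by linarith [hα.2], by linarith [hα.1]⟩
  have cE' : ContinuousOn (fun α => cosInt b (π / 2 - α)) (Ioo 0 (π / 2)) :=
    ((continuous_cosInt b).continuousOn (s := Ioo 0 (π / 2))).comp cr mr
  have cF' : ContinuousOn (fun α => sinTanInt b (π / 2 - α)) (Ioo 0 (π / 2)) := cF.comp cr mr
  have cA : ContinuousOn (solutionA b) (Ioo 0 (π / 2)) := by
    unfold solutionA quadA; fun_prop
  have cB : ContinuousOn (solutionB b) (Ioo 0 (π / 2)) := by
    unfold solutionB quadB; fun_prop
  -- The rationalized form of the root has a positive denominator even where `A = 0`, as happens at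
  -- `α = π/4`, so no separate limit is needed.
  unfold quadRoot
  refine ContinuousOn.div (by fun_prop) (by fun_prop) fun α hα => ?_
  have := solutionB_pos hb0 hb1 hα.1 hα.2
  positivity

end ThreeEnded

end

theorem proposition4p2 (k : ℕ) (hk : 2 ≤ k) :
    ∃ m : ℝ → ℝ,
      ContinuousOn m (Set.Ico (Real.pi / 4) (Real.pi / 2)) ∧
      ∀ α ∈ Set.Ico (Real.pi / 4) (Real.pi / 2),
        (0 ≤ m α ∧ m α < Real.cot α ∧ ThreeEnded.Compatible k (m α) α) ∧
        (∀ m' : ℝ, 0 ≤ m' → m' < Real.cot α → ThreeEnded.Compatible k m' α → m' = m α) ∧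
        (m α = 0 ∨ 2 * Real.tan α + Real.cot α < 1 / m α) ∧
        (-(m α * Real.cot α + 1) < m α * (Real.cot α + Real.tan α) ∧
          m α * (Real.cot α + Real.tan α) < 1 - m α * Real.tan α) := by
  have hkR : (2 : ℝ) ≤ k := by exact_mod_cast hk
  have hb0 : (0 : ℝ) < 2 / k := by positivity
  have hb1 : (2 : ℝ) / k ≤ 1 := (div_le_one (by positivity)).2 hkR
  refine ⟨fun α => ThreeEnded.quadRoot (ThreeEnded.solutionA (2 / k) α)
    (ThreeEnded.solutionB (2 / k) α),
    (ThreeEnded.continuousOn_quadRoot_solution hb0 hb1).mono fun α hα =>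
      ⟨by linarith [hα.1, Real.pi_pos], hα.2⟩, ?_⟩
  rintro α ⟨h0, h1⟩
  have hα0 : 0 < α := by linarith [Real.pi_pos]
  have hβ0 : 0 < π / 2 - α := by linarith
  have hβ1 : π / 2 - α < π / 2 := by linarith
  have hA := ThreeEnded.solutionA_nonneg hb0 hb1 h0 h1
  have hB := ThreeEnded.solutionB_pos hb0 hb1 hα0 h1
  have hE' := ThreeEnded.cosInt_pos hb0 hb1 hβ0 hβ1
  have hF' := ThreeEnded.sinTanInt_nonneg hb0 hb1 hβ0 hβ1
  obtain ⟨m0, hroot⟩ := ThreeEnded.quadRoot_spec hA hB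
  have hc : 0 < Real.cos α := Real.cos_pos_of_mem_Ioo ⟨by linarith, h1⟩
  have ha : 0 < Real.sin α := Real.sin_pos_of_pos_of_lt_pi hα0 (by linarith)
  have hac := Real.sin_sq_add_cos_sq α
  have ha1 : Real.sin α < 1 := by nlinarith
  have h' := ThreeEnded.sinTanInt_mul_cos_le hb0 hb1 hβ0 hβ1
  rw [Real.cos_pi_div_two_sub] at h'
  have hpos := ThreeEnded.quadratic_pos ha ha1 hac (ThreeEnded.cosInt_pos hb0 hb1 hα0 h1)
    (ThreeEnded.sinTanInt_nonneg hb0 hb1 hα0 h1) hE' hF' h'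
  set m := ThreeEnded.quadRoot (ThreeEnded.solutionA (2 / k) α) (ThreeEnded.solutionB (2 / k) α)
  have hm : m < Real.sin α * Real.cos α / (1 + Real.sin α ^ 2) :=
    ThreeEnded.lt_of_quadratic_lt hA hB (by positivity) (hroot.trans_lt hpos)
  have hQ := ThreeEnded.tilde_denominator_pos ha hc hac hE' hF' m0 hm
  rw [lt_div_iff₀ (by positivity)] at hm
  -- The bound on `m` is exactly this, because `2 tan α + cot α = (2a² + c²) / (a c) = (1 + a²) / (a
  -- c)`. It is also a rearrangement of the last ordering inequality.
  have hgrowth : m * (2 * Real.tan α + Real.cot α) < 1 := by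
    rw [Real.tan_eq_sin_div_cos, Real.cot_eq_cos_div_sin,
      show 2 * (Real.sin α / Real.cos α) + Real.cos α / Real.sin α
        = (1 + Real.sin α ^ 2) / (Real.sin α * Real.cos α) by
          rw [← hac]; field_simp; ring, mul_div_assoc', div_lt_one (by positivity)]
    exact hm
  have ht : 0 < Real.tan α := Real.tan_pos_of_pos_of_lt_pi_div_two hα0 h1
  have hcot : 0 < Real.cot α := by
    rw [Real.cot_eq_cos_div_sin]; positivity
  refine ⟨⟨m0, ?_, (ThreeEnded.compatible_iff hk h0 h1 m).2 ⟨hQ.ne', hroot⟩⟩,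
    fun m' p _ hm' => ?_, ?_, ?_, ?_⟩
  -- It suffices that `m < a c`, as `a² c < c`.
  · rw [Real.cot_eq_cos_div_sin, lt_div_iff₀ ha]
    nlinarith [mul_nonneg m0 (sq_nonneg (Real.sin α)), mul_pos ha hc,
      mul_pos (mul_pos ha hc) (sub_pos.2 ha1)]
  · exact ThreeEnded.quadratic_root_unique hA hB p m0
      ((ThreeEnded.compatible_iff hk h0 h1 m').1 hm').2 hroot
  · rcases m0.eq_or_lt with h | h
    · exact Or.inl h.symm
    · refine Or.inr ?_
      rw [lt_div_iff₀ h]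
      linarith
  · change -(m * Real.cot α + 1) < m * (Real.cot α + Real.tan α)
    have : 0 ≤ m * Real.cot α := by positivity
    have : 0 ≤ m * (Real.cot α + Real.tan α) := by positivity
    linarith
  · change m * (Real.cot α + Real.tan α) < 1 - m * Real.tan α
    linarith
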